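/- **Definitions.** The *Clifford gates* on a finite set $m$ of qubits are the unitaries on these qubits that map every Pauli string to $\pm$ a Pauli string under conjugation, up to global phase; there are finitely many. An $n$-qubit *circuit template* $\mathcal T=(m_1,\dots,m_R)$ is a sequence of subsets of $[n]$; it is $k$-*local* if $|m_w|=k$ for all $w$, and has *depth* $d$ if $1,\dots,R$ can be arranged in $d$ layers such that $w<w'$ with $m_w\cap m_{w'}\ne\emptyset$ implies that $w$ is in an earlier layer than $w'$. A *random Clifford circuit* with template $\mathcal T$ is $U=U_R\cdots U_2U_1$ with the $U_w$ independent uniformly random Clifford gates on $m_w$; its output state is $U|0^n\rangle$ and its output distribution is $Q_U(z)=|\langle z|U|0^n\rangle|^2$, $z\in\{0,1\}^n$. A *circuit architecture* of locality $k=k(n)$ and depth $d=d(n)$ is a family $\mathcal A=\{\mathcal T_n\}_{n\in\Gamma}$, with $\Gamma\subseteq\mathbb N$ infinite, of $k(n)$-local, depth-$d(n)$ templates $\mathcal T_n$ on $n$ qubits. A three-qubit state is *GHZ-type entangled* if some $C_1\otimes C_2\otimes C_3$ with single-qubit Clifford unitaries $C_a$ maps it to $\frac1{\sqrt2}(|000\rangle+|111\rangle)$.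 Three qubits exhibit *GHZ-type measurement-induced entanglement (MIE)* in an $n$-qubit state if, after measuring all other qubits in the computational basis, their normalized state is GHZ-type entangled for every outcome of nonzero probability. The architecture has the *long-range tripartite MIE property* if there is $c>0$ such that for all $n\in\Gamma$ with $n\ge 3$, with probability at least $c$ over a random Clifford circuit $U$ with template $\mathcal T_n$ and an independent uniformly random triple of distinct qubits, the triple exhibits GHZ-type MIE in $U|0^n\rangle$. A *probabilistic classical circuit for* $\mathcal T_n$ of fan-in $K$ and depth $D$ is a Boolean circuit (a directed acyclic graph of gates computing arbitrary Boolean functions of at most $K$ bits, with unbounded fan-out and at most $D$ gates on any path to an output bit) with $n$ output bits, whose input bits are a binary description of each of the gates $U_1,\dots,U_R$ (in any injective encoding) and a random bit string of any length, drawn from any distribution that does not depend on $U$. Its output distribution on input $U$ is denoted $P_U$. **Theorem.** Let $\mathcal A=\{\mathcal T_n\}_{n\in\Gamma}$ be a $k$-local, depth-$d$ circuit architecture, where $k$ and $d$ are constants or, more generally, functions of $n$ with $k(n)=o(n^{1/4})$. Suppose that $\mathcal A$ has the long-range tripartite MIE property. Then there are a real $\alpha>0$ and a positive integer $n_0$ such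 that the following holds for all $n\in\Gamma$ with $n\ge\max\{n_0,(10\,d(n))^4\}$ and all integers $K\ge 2$ and $D\ge 0$. If a probabilistic classical circuit for $\mathcal T_n$ of fan-in $K$ and depth $D$ satisfies $$\mathbb E_{U_1,\dots,U_R}\big[\|P_U-Q_U\|_1\big]=\mathbb E_{U_1,\dots,U_R}\Big[\sum_{z\in\{0,1\}^n}|P_U(z)-Q_U(z)|\Big]<\alpha$$ for independent uniformly random Clifford gates $U_w$ on $m_w$, then $$D\ \ge\ \frac14\,\frac{\log n}{\log K}.$$ -/

import Mathlib

open scoped Matrix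
open Asymptotics Filter

/-- The one-qubit Pauli matrices `I, X, Y, Z`; the basis states `|0⟩, |1⟩` are `false, true`. -/
noncomputable def pauliMatrix : Fin 4 → Matrix Bool Bool ℂ
  | 0 => fun a b => if a = b then 1 else 0
  | 1 => fun a b => if a = b then 0 else 1
  | 2 => fun a b => if a = b then 0 else if a = true then Complex.I else -Complex.I
  | 3 => fun a b => if a = b then (if a = true then -1 else 1) else 0

/-- The tensor product of one-qubit Pauli matrices described by `p`, on the qubits in `ι`. -/
noncomputable def pauliString {ι : Type} [Fintype ι] (p : ι → Fin 4) :
    Matrix (ι → Bool) (ι → Bool) ℂ :=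
  fun x y => ∏ q, pauliMatrix (p q) (x q) (y q)

/-- `A` is a Clifford unitary on the qubits in `ι`: it is unitary and maps every Pauli string to
plus or minus a Pauli string under conjugation. -/
def IsClifford {ι : Type} [Fintype ι] [DecidableEq ι] (A : Matrix (ι → Bool) (ι → Bool) ℂ) :
    Prop :=
  A ∈ Matrix.unitaryGroup (ι → Bool) ℂ ∧
    ∀ p : ι → Fin 4, ∃ q : ι → Fin 4,
      A * pauliString p * Aᴴ = pauliString q ∨ A * pauliString p * Aᴴ = -pauliString q

/-- The Clifford unitaries on the qubits in `ι`. -/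
abbrev CliffordUnitary (ι : Type) [Fintype ι] [DecidableEq ι] : Type :=
  {A : Matrix (ι → Bool) (ι → Bool) ℂ // IsClifford A}

/-- Equality of Clifford unitaries up to a global phase. -/
def phaseSetoid (ι : Type) [Fintype ι] [DecidableEq ι] : Setoid (CliffordUnitary ι) where
  r A B := ∃ z : ℂ, ‖z‖ = 1 ∧ A.1 = z • B.1
  iseqv := by
    refine ⟨fun A => ⟨1, by simp, by simp⟩, ?_, ?_⟩
    · rintro A B ⟨z, hz, h⟩
      have hz0 : z ≠ 0 := by rintro rfl; simp at hz
      exact ⟨z⁻¹, by simp [hz], by rw [h, smul_smul, inv_mul_cancel₀ hz0, one_smul]⟩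
    · rintro A B C ⟨z, hz, h⟩ ⟨w, hw, h'⟩
      exact ⟨z * w, by simp [hz, hw], by rw [h, h', smul_smul]⟩

/-- A Clifford gate on the qubits in `ι`: a Clifford unitary up to a global phase. -/
abbrev CliffordGate (ι : Type) [Fintype ι] [DecidableEq ι] : Type :=
  Quotient (phaseSetoid ι)

/-- A matrix that commutes with all Pauli strings is a scalar. -/
theorem eq_smul_one_of_commute_pauliString {ι : Type} [Fintype ι] [DecidableEq ι]
    (M : Matrix (ι → Bool) (ι → Bool) ℂ)
    (hM : ∀ p : ι → Fin 4, M * pauliString p = pauliString p * M) :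
    M = M (fun _ => false) (fun _ => false) • (1 : Matrix (ι → Bool) (ι → Bool) ℂ) := by
  have hX : ∀ a x y : ι → Bool,
      pauliString (fun q => if a q = true then (1 : Fin 4) else 0) x y =
        if x = (fun q => xor (y q) (a q)) then 1 else 0 := by
    intro a x y
    have h1 : ∀ q, pauliMatrix (if a q = true then (1 : Fin 4) else 0) (x q) (y q) =
        if x q = xor (y q) (a q) then 1 else 0 := by
      intro q
      cases a q <;> cases x q <;> cases y q <;> simp [pauliMatrix]
    simp only [pauliString, h1, Finset.prod_ite_zero, Finset.prod_const_one, funext_iff,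
      Finset.mem_univ, true_imp_iff]
  have hZ : ∀ (i : ι) (x y : ι → Bool),
      pauliString (fun q => if q = i then (3 : Fin 4) else 0) x y =
        if x = y then (if x i = true then -1 else 1) else 0 := by
    intro i x y
    have h1 : ∀ q, pauliMatrix (if q = i then (3 : Fin 4) else 0) (x q) (y q) =
        (if x q = y q then 1 else 0) * (if q = i then (if x i = true then -1 else 1) else 1) := by
      intro q
      by_cases hq : q = i
      · subst hq; simp only [pauliMatrix, if_true]; split_ifs <;> simp
      · simp [pauliMatrix, hq]
    simp only [pauliString, h1, Finset.prod_mul_distrib, Finset.prod_ite_zero,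
      Finset.prod_const_one, Finset.prod_ite_eq', Finset.mem_univ, true_imp_iff, if_true,
      funext_iff]
    split_ifs <;> simp
  ext x y
  by_cases hxy : x = y
  · subst hxy
    have h := congrFun (congrFun (hM (fun q => if x q = true then (1 : Fin 4) else 0)) x)
      (fun _ => false)
    rw [Matrix.mul_apply, Matrix.mul_apply] at h
    simp only [hX] at h
    have e : ∀ z : ι → Bool, (x = fun q => xor (z q) (x q)) ↔ z = fun _ => false := by
      intro z
      simp only [funext_iff]
      refine forall_congr' fun q => ?_
      cases x q <;> cases z q <;> simp
    simp only [e] at h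
    simpa using h
  · obtain ⟨i, hi⟩ : ∃ i, x i ≠ y i := by
      by_contra hc
      push Not at hc
      exact hxy (funext hc)
    have h := congrFun (congrFun (hM (fun q => if q = i then (3 : Fin 4) else 0)) x) y
    rw [Matrix.mul_apply, Matrix.mul_apply] at h
    simp only [hZ] at h
    simp only [mul_ite, ite_mul, mul_zero, zero_mul, Finset.sum_ite_eq, Finset.sum_ite_eq',
      Finset.mem_univ, if_true] at h
    have h0 : M x y = 0 := by
      cases hx : x i <;> cases hy : y i <;> simp [hx, hy] at h hi ⊢ <;>
        first
          | exact self_eq_neg.mp h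
          | exact neg_eq_self.mp h
    simp [h0, hxy]

instance instFiniteCliffordGate (ι : Type) [Fintype ι] [DecidableEq ι] :
    Finite (CliffordGate ι) := by
  classical
  have key : ∀ A : CliffordUnitary ι, ∃ f : (ι → Fin 4) → (ι → Fin 4) × Bool, ∀ p,
      A.1 * pauliString p * (A.1)ᴴ =
        (if (f p).2 = true then (1 : ℂ) else -1) • pauliString (f p).1 := by
    intro A
    have h : ∀ p : ι → Fin 4, ∃ s : (ι → Fin 4) × Bool,
        A.1 * pauliString p * (A.1)ᴴ =
          (if s.2 = true then (1 : ℂ) else -1) • pauliString s.1 := by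
      intro p
      obtain ⟨q, hq | hq⟩ := A.2.2 p
      · exact ⟨(q, true), by simpa using hq⟩
      · exact ⟨(q, false), by simpa using hq⟩
    choose f hf using h
    exact ⟨f, hf⟩
  choose f hf using key
  refine Finite.of_injective (fun g : CliffordGate ι => f (Quotient.out g)) ?_
  intro g g' h
  have h : f (Quotient.out g) = f (Quotient.out g') := h
  generalize hA : Quotient.out g = A at h
  generalize hB : Quotient.out g' = B at h
  have hU : (A.1)ᴴ * A.1 = 1 := (Matrix.mem_unitaryGroup_iff'.1 A.2.1)
  have hV : (B.1)ᴴ * B.1 = 1 := (Matrix.mem_unitaryGroup_iff'.1 B.2.1)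
  have hV' : B.1 * (B.1)ᴴ = 1 := (Matrix.mem_unitaryGroup_iff.1 B.2.1)
  have hc : ∀ p, A.1 * pauliString p * (A.1)ᴴ = B.1 * pauliString p * (B.1)ᴴ := by
    intro p; rw [hf A p, hf B p, h]
  have hM := eq_smul_one_of_commute_pauliString ((B.1)ᴴ * A.1) (by
    intro p
    calc (B.1)ᴴ * A.1 * pauliString p
        = (B.1)ᴴ * (A.1 * pauliString p * (A.1)ᴴ) * A.1 := by
          simp only [Matrix.mul_assoc, hU, Matrix.mul_one]
      _ = ((B.1)ᴴ * B.1) * pauliString p * ((B.1)ᴴ * A.1) := by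
          rw [hc p]; simp only [Matrix.mul_assoc]
      _ = pauliString p * ((B.1)ᴴ * A.1) := by rw [hV, Matrix.one_mul])
  set z := ((B.1)ᴴ * A.1) (fun _ => false) (fun _ => false) with hz
  have hAB : A.1 = z • B.1 := by
    calc A.1 = B.1 * ((B.1)ᴴ * A.1) := by rw [← Matrix.mul_assoc, hV', Matrix.one_mul]
      _ = z • B.1 := by rw [hM]; simp
  have hzn : ‖z‖ = 1 := by
    rw [hAB, Matrix.conjTranspose_smul, Matrix.smul_mul, Matrix.mul_smul, hV, smul_smul] at hU
    have h1 := congrFun (congrFun hU (fun _ => false)) (fun _ => false)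
    simp only [Matrix.smul_apply, Matrix.one_apply_eq, smul_eq_mul, mul_one] at h1
    have h2 := congrArg norm h1
    rw [norm_mul, norm_star, norm_one] at h2
    nlinarith [norm_nonneg z]
  rw [← Quotient.out_eq g, ← Quotient.out_eq g', hA, hB]
  exact Quotient.sound ⟨z, hzn, hAB⟩

noncomputable instance instFintypeCliffordGate (ι : Type) [Fintype ι] [DecidableEq ι] :
    Fintype (CliffordGate ι) :=
  Fintype.ofFinite _

/-- An `n`-qubit circuit template: the supports of the gates, in the order of application. -/
structure CircuitTemplate (n : ℕ) where
  /-- the number of gates -/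
  R : ℕ
  /-- the set of qubits on which each gate acts -/
  supp : Fin R → Finset (Fin n)

namespace CircuitTemplate

/-- The template is `k`-local if each gate acts on exactly `k` qubits. -/
def IsLocal {n : ℕ} (T : CircuitTemplate n) (k : ℕ) : Prop :=
  ∀ w, (T.supp w).card = k

/-- The template has depth `d` if its gates can be arranged in `d` layers, such that gates that
share a qubit are in different layers and in their order of application. -/
def HasDepth {n : ℕ} (T : CircuitTemplate n) (d : ℕ) : Prop :=
  ∃ layer : Fin T.R → Fin d,
    ∀ w w', w < w' → ¬ Disjoint (T.supp w) (T.supp w') → layer w < layer w'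

/-- A Clifford circuit in the template: a choice of a Clifford gate on each support. -/
abbrev Gates {n : ℕ} (T : CircuitTemplate n) : Type :=
  (w : Fin T.R) → CliffordGate (T.supp w)

end CircuitTemplate

/-- The operator `A` on the qubits in `m`, tensored with the identity on the other qubits. -/
def actOn {n : ℕ} (m : Finset (Fin n)) (A : Matrix (m → Bool) (m → Bool) ℂ) :
    Matrix (Fin n → Bool) (Fin n → Bool) ℂ :=
  fun x y => if ∀ q, q ∉ m → x q = y q then A (fun q => x q) (fun q => y q) else 0

/-- The unitary `U_R ⋯ U_2 U_1` of the circuit. A representative of each gate is chosen, so this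
is determined up to a global phase, on which nothing below depends. -/
noncomputable def circuitUnitary {n : ℕ} (T : CircuitTemplate n) (U : T.Gates) :
    Matrix (Fin n → Bool) (Fin n → Bool) ℂ :=
  (List.ofFn fun w => actOn (T.supp w) (Quotient.out (U w)).1).reverse.prod

/-- The output state `U |0ⁿ⟩`, as the function `z ↦ ⟨z| U |0ⁿ⟩`. -/
noncomputable def outputState {n : ℕ} (T : CircuitTemplate n) (U : T.Gates) :
    (Fin n → Bool) → ℂ :=
  circuitUnitary T U *ᵥ Pi.single (fun _ => false) 1

/-- The output distribution `Q_U(z) = |⟨z| U |0ⁿ⟩|²`. -/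
noncomputable def quantumProb {n : ℕ} (T : CircuitTemplate n) (U : T.Gates)
    (z : Fin n → Bool) : ℝ :=
  ‖outputState T U z‖ ^ 2

/-- The GHZ state `(|000⟩ + |111⟩) / √2`. -/
noncomputable def ghzState : (Fin 3 → Bool) → ℂ :=
  fun y => if y = (fun _ => false) ∨ y = (fun _ => true) then ((1 / √2 : ℝ) : ℂ) else 0

/-- The tensor product of three one-qubit operators. -/
def tensorThree (C : Fin 3 → Matrix (Unit → Bool) (Unit → Bool) ℂ) :
    Matrix (Fin 3 → Bool) (Fin 3 → Bool) ℂ :=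
  fun x y => ∏ a, C a (fun _ => x a) (fun _ => y a)

/-- The three-qubit state `Φ` is GHZ-type entangled: one-qubit Clifford unitaries map it to the
GHZ state. -/
def IsGHZType (Φ : (Fin 3 → Bool) → ℂ) : Prop :=
  ∃ C : Fin 3 → Matrix (Unit → Bool) (Unit → Bool) ℂ,
    (∀ a, IsClifford (C a)) ∧ tensorThree C *ᵥ Φ = ghzState

/-- The unnormalized state of the qubits `t 0, t 1, t 2` of `ψ`, after the other qubits have been
measured in the computational basis with the outcome given by the values of `x` there. -/
noncomputable def projectedState {n : ℕ} (ψ : (Fin n → Bool) → ℂ) (t : Fin 3 ↪ Fin n)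
    (x : Fin n → Bool) : (Fin 3 → Bool) → ℂ :=
  fun y => ψ (Function.extend t y x)

/-- The qubits `t 0, t 1, t 2` exhibit GHZ-type measurement-induced entanglement in `ψ`: for every
measurement outcome of nonzero probability, their normalized post-measurement state is GHZ-type
entangled. -/
def HasGHZTypeMIE {n : ℕ} (ψ : (Fin n → Bool) → ℂ) (t : Fin 3 ↪ Fin n) : Prop :=
  ∀ x : Fin n → Bool, projectedState ψ t x ≠ 0 →
    IsGHZType (((√(∑ y, ‖projectedState ψ t x y‖ ^ 2) : ℝ) : ℂ)⁻¹ • projectedState ψ t x)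

/-- A circuit architecture: circuit templates on `n` qubits for an infinite set of values of `n`,
of locality `k n` and depth `d n`. -/
structure CircuitArchitecture (k d : ℕ → ℕ) where
  Γ : Set ℕ
  infinite : Γ.Infinite
  template : (n : Γ) → CircuitTemplate n
  isLocal : ∀ n : Γ, (template n).IsLocal (k n)
  hasDepth : ∀ n : Γ, (template n).HasDepth (d n)

/-- The long-range tripartite MIE property for random Clifford circuits: with probability at least
a constant `c > 0` over independent uniformly random Clifford gates and a uniformly random triple
of qubits, the triple exhibits GHZ-type MIE in the output state. Triples are taken with an order,
on which GHZ-type MIE does not depend. -/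
def LongRangeTripartiteMIE {k d : ℕ → ℕ} (A : CircuitArchitecture k d) : Prop :=
  ∃ c : ℝ, 0 < c ∧ ∀ n : A.Γ, 3 ≤ (n : ℕ) →
    c ≤ (Nat.card {e : (A.template n).Gates × (Fin 3 ↪ Fin n) //
            HasGHZTypeMIE (outputState (A.template n) e.1) e.2} : ℝ) /
          (Nat.card ((A.template n).Gates × (Fin 3 ↪ Fin n)) : ℝ)

/-- A Boolean circuit with input variables in `ι` and `n` output bits, as a directed acyclic graph
of gates in topological order. A gate computes any Boolean function of its inputs, each of which is
an input variable or the value of an earlier gate; fan-out is unbounded. -/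
structure BoolCircuit (ι : Type) (n : ℕ) where
  /-- the number of gates -/
  size : ℕ
  /-- the fan-in of each gate -/
  fanIn : Fin size → ℕ
  /-- the inputs of each gate -/
  src : (g : Fin size) → Fin (fanIn g) → ι ⊕ Fin (g : ℕ)
  /-- the function computed by each gate -/
  op : (g : Fin size) → (Fin (fanIn g) → Bool) → Bool
  /-- the source of each output bit -/
  out : Fin n → ι ⊕ Fin size

namespace BoolCircuit

variable {ι : Type} {n : ℕ}

/-- The value of the gate `g` on the input `x`. -/
def gateValue (C : BoolCircuit ι n) (x : ι → Bool) (g : Fin C.size) : Bool :=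
  C.op g fun a =>
    match C.src g a with
    | Sum.inl i => x i
    | Sum.inr g' => C.gateValue x ⟨g'.1, g'.2.trans g.2⟩
  termination_by g.1
  decreasing_by exact g'.2

/-- The output of the circuit on the input `x`. -/
def eval (C : BoolCircuit ι n) (x : ι → Bool) : Fin n → Bool := fun v =>
  match C.out v with
  | Sum.inl i => x i
  | Sum.inr g => C.gateValue x g

/-- The largest number of gates on a path that ends in the gate `g`. -/
def gateDepth (C : BoolCircuit ι n) (g : Fin C.size) : ℕ :=
  1 + Finset.univ.sup fun a =>
    match C.src g a with
    | Sum.inl _ => 0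
    | Sum.inr g' => C.gateDepth ⟨g'.1, g'.2.trans g.2⟩
  termination_by g.1
  decreasing_by exact g'.2

/-- The depth of the circuit: the largest number of gates on a path that ends in an output bit. -/
def depth (C : BoolCircuit ι n) : ℕ :=
  Finset.univ.sup fun v : Fin n =>
    match C.out v with
    | Sum.inl _ => 0
    | Sum.inr g => C.gateDepth g

end BoolCircuit

/-- A probabilistic classical circuit whose input is a Clifford circuit in the template `T`.
It reads a binary description of each gate, in any encoding, and a random bit string with any
distribution that does not depend on the gates. -/
structure ProbClassicalCircuit {n : ℕ} (T : CircuitTemplate n) where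
  /-- the number of bits that describe each gate -/
  len : Fin T.R → ℕ
  /-- the binary description of each gate -/
  enc : (w : Fin T.R) → CliffordGate (T.supp w) ↪ (Fin (len w) → Bool)
  /-- the number of random bits -/
  numRandom : ℕ
  /-- the distribution of the random string -/
  randomDist : PMF (Fin numRandom → Bool)
  /-- the Boolean circuit -/
  circuit : BoolCircuit ((Σ w : Fin T.R, Fin (len w)) ⊕ Fin numRandom) n

namespace ProbClassicalCircuit

/-- The output of the circuit on input `U` and random string `r`. -/
def output {n : ℕ} {T : CircuitTemplate n} (F : ProbClassicalCircuit T) (U : T.Gates)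
    (r : Fin F.numRandom → Bool) : Fin n → Bool :=
  F.circuit.eval (Sum.elim (fun s => F.enc s.1 (U s.1) s.2) r)

/-- The output distribution `P_U` on input `U`. -/
noncomputable def prob {n : ℕ} {T : CircuitTemplate n} (F : ProbClassicalCircuit T) (U : T.Gates)
    (z : Fin n → Bool) : ℝ :=
  ((F.randomDist.map (F.output U)) z).toReal

/-- The expectation of `‖P_U - Q_U‖₁` over independent uniformly random Clifford gates. -/
noncomputable def expectedError {n : ℕ} {T : CircuitTemplate n} (F : ProbClassicalCircuit T) : ℝ :=
  (∑ U : T.Gates, ∑ z : Fin n → Bool, |F.prob U z - quantumProb T U z|) /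
    (Fintype.card T.Gates : ℝ)

end ProbClassicalCircuit

/-!
# Sampling the output of shallow Clifford circuits with measurement-induced entanglement

Fix the random string of the classical circuit. If its depth is below `(log n / log K) / 4`, each
output bit depends on at most `K ^ D ≤ n ^ (1 / 4)` of the gates. Since gates act on
`o(n ^ (1 / 4))` qubits, only `o(n ^ 2)` pairs of qubits are such that some output bit depends on
gates on both of them (`card_not_isSeparated_le`, `nonseparated_bound`). Hence some triple of qubits
exhibits GHZ-type MIE with constant probability, while each output bit depends on the last gate on
at most one qubit of the triple, and the output bit on a qubit of the triple only on the last gate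
on that qubit.

Multiplying the last gates on the three qubits by one-qubit Clifford gates permutes the circuits,
and rotates the three qubits of the output state (`outputState_rotateTriple`). The number of such
rotations does not depend on `n`. It therefore suffices that for a circuit with GHZ-type MIE at the
triple, the classical output is impossible in the quantum circuit for at least one rotation
(`exists_rotation_output_impossible`, `card_hasGHZTypeMIE_le`); the error is at least the
probability of an impossible output (`ProbClassicalCircuit.le_expectedError`).

To see this, choose local Clifford frames in which some post-measurement state of the triple is
GHZ. As the output state is a stabilizer state, the GHZ stabilizers `XXX`, `XYY` and `YXY` extend to
stabilizers of the output state that are products of `I` and `Z` on the measured qubits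
(`exists_stabilizer_of_projectedState_eq`). Measuring the triple in the bases `X`, `Y` and `Z` then
amounts to a GHZ game in which the parities of the outcomes are corrected by parities of measured
bits. Each measured bit may depend on the basis of one qubit of the triple, and this alone would
allow a classical strategy to satisfy the four parity relations of the GHZ game. The relations for
the stabilizers `ZZI`, `ZIZ`, `IZZ`, for both `X` and `Y` on the remaining qubit, forbid that the
correction of `ZZ` on two qubits depends on the basis of the third. The product of all ten relations
is contradictory (`not_forall_output_possible`).
-/

/-! ### Tensor products of one-qubit matrices -/

/-- The tensor product of the one-qubit matrices `M q`, on the qubits in `ι`. -/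
def tensorMatrix {ι : Type} [Fintype ι] (M : ι → Matrix Bool Bool ℂ) :
    Matrix (ι → Bool) (ι → Bool) ℂ :=
  fun x y => ∏ q, M q (x q) (y q)

theorem pauliMatrix_zero : pauliMatrix 0 = 1 := by
  ext a b; simp [pauliMatrix, Matrix.one_apply]

theorem pauliMatrix_one_apply (a b : Bool) : pauliMatrix 1 a b = if a = b then 0 else 1 := rfl

theorem pauliMatrix_two_apply (a b : Bool) :
    pauliMatrix 2 a b = if a = b then 0 else if a = true then Complex.I else -Complex.I := rfl

theorem pauliMatrix_three_apply (a b : Bool) :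
    pauliMatrix 3 a b = if a = b then (if a = true then -1 else 1) else 0 := rfl

/-- The Pauli matrices are orthogonal for the trace form. -/
theorem trace_pauliMatrix_mul (i j : Fin 4) :
    Matrix.trace (pauliMatrix i * pauliMatrix j) = if i = j then 2 else 0 := by
  fin_cases i <;> fin_cases j <;>
    simp [Matrix.trace, Matrix.mul_apply, pauliMatrix_zero, pauliMatrix_one_apply,
      pauliMatrix_two_apply, pauliMatrix_three_apply] <;> norm_num

section TensorMatrix

variable {ι : Type} [Fintype ι]

theorem pauliString_eq_tensorMatrix (p : ι → Fin 4) :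
    pauliString p = tensorMatrix fun q => pauliMatrix (p q) := rfl

theorem tensorMatrix_mul [DecidableEq ι] (M N : ι → Matrix Bool Bool ℂ) :
    tensorMatrix M * tensorMatrix N = tensorMatrix fun q => M q * N q := by
  ext x y
  simp only [tensorMatrix, Matrix.mul_apply, ← Finset.prod_mul_distrib]
  rw [Finset.prod_univ_sum, Fintype.piFinset_univ]

theorem tensorMatrix_one : tensorMatrix (fun _ : ι => (1 : Matrix Bool Bool ℂ)) = 1 := by
  classical
  ext x y
  simp only [tensorMatrix, Matrix.one_apply, Finset.prod_ite_zero, Finset.prod_const_one,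
    funext_iff, Finset.mem_univ, true_imp_iff]

theorem tensorMatrix_conjTranspose (M : ι → Matrix Bool Bool ℂ) :
    (tensorMatrix M)ᴴ = tensorMatrix fun q => (M q)ᴴ := by
  ext x y
  simp [tensorMatrix, Matrix.conjTranspose_apply]

theorem tensorMatrix_smul (c : ι → ℂ) (M : ι → Matrix Bool Bool ℂ) :
    tensorMatrix (fun q => c q • M q) = (∏ q, c q) • tensorMatrix M := by
  ext x y
  simp [tensorMatrix, Finset.prod_mul_distrib]

theorem tensorMatrix_diagonal_mulVec [DecidableEq ι] (δ : ι → Bool → ℂ) (φ : (ι → Bool) → ℂ)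
    (z : ι → Bool) :
    (tensorMatrix (fun q => Matrix.diagonal (δ q)) *ᵥ φ) z = (∏ q, δ q (z q)) * φ z := by
  have h : tensorMatrix (fun q => Matrix.diagonal (δ q)) =
      Matrix.diagonal fun x : ι → Bool => ∏ q, δ q (x q) := by
    ext x y
    by_cases hxy : x = y
    · subst hxy; simp [tensorMatrix]
    · obtain ⟨q, hq⟩ := Function.ne_iff.1 hxy
      rw [Matrix.diagonal_apply_ne _ hxy]
      exact Finset.prod_eq_zero (Finset.mem_univ q) (Matrix.diagonal_apply_ne _ hq)
  rw [h, Matrix.mulVec_diagonal]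

theorem tensorMatrix_mem_unitaryGroup [DecidableEq ι] {M : ι → Matrix Bool Bool ℂ}
    (hM : ∀ q, M q ∈ Matrix.unitaryGroup Bool ℂ) :
    tensorMatrix M ∈ Matrix.unitaryGroup (ι → Bool) ℂ := by
  rw [Matrix.mem_unitaryGroup_iff, Matrix.star_eq_conjTranspose, tensorMatrix_conjTranspose,
    tensorMatrix_mul, ← tensorMatrix_one]
  congr 1
  funext q
  exact Matrix.mem_unitaryGroup_iff.1 (hM q)

end TensorMatrix

/-! ### Operators on a subset of the qubits -/

section ActOn

variable {n : ℕ} (m : Finset (Fin n))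

theorem actOn_eq_kronecker (A : Matrix (m → Bool) (m → Bool) ℂ) :
    actOn m A = (Matrix.kroneckerMap (· * ·) A
      (1 : Matrix ({q // q ∉ m} → Bool) ({q // q ∉ m} → Bool) ℂ)).submatrix
        (Equiv.piEquivPiSubtypeProd (· ∈ m) fun _ => Bool)
        (Equiv.piEquivPiSubtypeProd (· ∈ m) fun _ => Bool) := by
  ext x y
  have h : (∀ q, q ∉ m → x q = y q) ↔
      (fun q : {q // q ∉ m} => x q) = fun q : {q // q ∉ m} => y q := by
    simp [funext_iff]
  simp only [actOn, Matrix.submatrix_apply, Matrix.kroneckerMap_apply, Matrix.one_apply,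
    Equiv.piEquivPiSubtypeProd_apply, h]
  split_ifs <;> simp

theorem tensorMatrix_eq_kronecker (M : Fin n → Matrix Bool Bool ℂ) :
    tensorMatrix M = (Matrix.kroneckerMap (· * ·) (tensorMatrix fun q : m => M q)
      (tensorMatrix fun q : {q // q ∉ m} => M q)).submatrix
        (Equiv.piEquivPiSubtypeProd (· ∈ m) fun _ => Bool)
        (Equiv.piEquivPiSubtypeProd (· ∈ m) fun _ => Bool) := by
  ext x y
  simp only [tensorMatrix, Matrix.submatrix_apply, Matrix.kroneckerMap_apply,
    Equiv.piEquivPiSubtypeProd_apply]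
  convert (Fintype.prod_subtype_mul_prod_subtype (· ∈ m) fun q => M q (x q) (y q)).symm

theorem actOn_mul (A B : Matrix (m → Bool) (m → Bool) ℂ) :
    actOn m A * actOn m B = actOn m (A * B) := by
  simp only [actOn_eq_kronecker, Matrix.submatrix_mul_equiv,
    ← Matrix.mul_kronecker_mul, mul_one]

theorem actOn_one : actOn m 1 = 1 := by
  simp [actOn_eq_kronecker]

theorem actOn_smul (c : ℂ) (A : Matrix (m → Bool) (m → Bool) ℂ) :
    actOn m (c • A) = c • actOn m A := by
  ext x y; simp [actOn]

theorem actOn_neg (A : Matrix (m → Bool) (m → Bool) ℂ) : actOn m (-A) = -actOn m A := by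
  rw [← neg_one_smul ℂ, actOn_smul, neg_one_smul]

theorem actOn_conjTranspose (A : Matrix (m → Bool) (m → Bool) ℂ) :
    (actOn m A)ᴴ = actOn m Aᴴ := by
  ext x y
  simp only [actOn, Matrix.conjTranspose_apply, eq_comm (a := y _)]
  split_ifs <;> simp

theorem actOn_tensorMatrix (M : Fin n → Matrix Bool Bool ℂ) (hM : ∀ q, q ∉ m → M q = 1) :
    actOn m (tensorMatrix fun q : m => M q) = tensorMatrix M := by
  rw [actOn_eq_kronecker, tensorMatrix_eq_kronecker m M]
  have : (fun q : {q // q ∉ m} => M q) = fun _ => 1 := funext fun q => hM q q.2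
  rw [this, tensorMatrix_one]

theorem actOn_commute_tensorMatrix (A : Matrix (m → Bool) (m → Bool) ℂ)
    (M : Fin n → Matrix Bool Bool ℂ) (hM : ∀ q ∈ m, M q = 1) :
    Commute (actOn m A) (tensorMatrix M) := by
  have : (fun q : m => M q) = fun _ => 1 := funext fun q => hM q q.2
  rw [actOn_eq_kronecker, tensorMatrix_eq_kronecker m M, this, tensorMatrix_one]
  simp only [Commute, SemiconjBy, Matrix.submatrix_mul_equiv,
    ← Matrix.mul_kronecker_mul,
    mul_one, one_mul]

end ActOn

/-! ### Clifford unitaries -/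

section Clifford

variable {ι : Type} [Fintype ι] [DecidableEq ι]

theorem IsClifford.one : IsClifford (1 : Matrix (ι → Bool) (ι → Bool) ℂ) :=
  ⟨one_mem _, fun p => ⟨p, Or.inl (by simp)⟩⟩

theorem IsClifford.mul {A B : Matrix (ι → Bool) (ι → Bool) ℂ} (hA : IsClifford A)
    (hB : IsClifford B) : IsClifford (A * B) := by
  refine ⟨mul_mem hA.1 hB.1, fun p => ?_⟩
  obtain ⟨q, hq⟩ := hB.2 p
  obtain ⟨r, hr⟩ := hA.2 q
  have e : A * B * pauliString p * (A * B)ᴴ = A * (B * pauliString p * Bᴴ) * Aᴴ := by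
    simp only [Matrix.conjTranspose_mul, Matrix.mul_assoc]
  refine ⟨r, ?_⟩
  rw [e]
  rcases hq with hq | hq <;> rw [hq] <;> rcases hr with hr | hr <;> simp [hr]

theorem IsClifford.list_prod {l : List (Matrix (ι → Bool) (ι → Bool) ℂ)}
    (h : ∀ A ∈ l, IsClifford A) : IsClifford l.prod := by
  induction l with
  | nil => simpa using IsClifford.one
  | cons A l ih =>
    rw [List.prod_cons]
    exact (h A (by simp)).mul (ih fun B hB => h B (by simp [hB]))

/-- Distinct Pauli strings are orthogonal for the trace form, so they are not equal up to sign. -/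
theorem pauliString_injective_up_to_sign {p p' : ι → Fin 4}
    (h : pauliString p = pauliString p' ∨ pauliString p = -pauliString p') : p = p' := by
  have ht (p p' : ι → Fin 4) : Matrix.trace (pauliString p * pauliString p') =
      ∏ q, if p q = p' q then 2 else 0 := by
    simp only [pauliString_eq_tensorMatrix, tensorMatrix_mul, ← trace_pauliMatrix_mul]
    simp only [Matrix.trace, Matrix.diag, tensorMatrix]
    rw [Finset.prod_univ_sum, Fintype.piFinset_univ]
  by_contra hne
  obtain ⟨q, hq⟩ := Function.ne_iff.1 hne
  have h0 : Matrix.trace (pauliString p * pauliString p') = 0 := by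
    rw [ht]
    exact Finset.prod_eq_zero (Finset.mem_univ q) (if_neg hq)
  have h1 : Matrix.trace (pauliString p' * pauliString p') ≠ 0 := by
    rw [ht]; simp
  rcases h with h | h <;> rw [h] at h0
  · exact h1 h0
  · rw [Matrix.neg_mul, Matrix.trace_neg, neg_eq_zero] at h0
    exact h1 h0

/-- The inverse of a Clifford unitary is a Clifford unitary: a Clifford unitary acts injectively,
hence surjectively, on the finite set of Pauli strings up to sign. -/
theorem IsClifford.conjTranspose {A : Matrix (ι → Bool) (ι → Bool) ℂ} (hA : IsClifford A) :
    IsClifford Aᴴ := by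
  have hU : Aᴴ * A = 1 := Matrix.mem_unitaryGroup_iff'.1 hA.1
  refine ⟨Matrix.mem_unitaryGroup_iff.2 (by simpa [Matrix.star_eq_conjTranspose] using hU),
    fun p => ?_⟩
  choose f hf using hA.2
  have hback {P Q : Matrix (ι → Bool) (ι → Bool) ℂ} (h : A * P * Aᴴ = Q) : P = Aᴴ * Q * A := by
    rw [← h]
    calc P = (Aᴴ * A) * P * (Aᴴ * A) := by rw [hU]; simp
      _ = _ := by simp only [Matrix.mul_assoc]
  have hinj : Function.Injective f := by
    intro p p' h
    refine pauliString_injective_up_to_sign ?_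
    rcases hf p with h1 | h1 <;> rcases hf p' with h2 | h2 <;>
      rw [hback h1, hback h2, h] <;> simp
  obtain ⟨q, rfl⟩ := Finite.surjective_of_injective hinj p
  refine ⟨q, ?_⟩
  rw [Matrix.conjTranspose_conjTranspose]
  rcases hf q with h | h
  · exact Or.inl (hback h).symm
  · right
    rw [hback h]; simp

end Clifford

theorem IsClifford.actOn {n : ℕ} {m : Finset (Fin n)} {A : Matrix (m → Bool) (m → Bool) ℂ}
    (hA : IsClifford A) : IsClifford (actOn m A) := by
  refine ⟨?_, fun p => ?_⟩
  · rw [Matrix.mem_unitaryGroup_iff, Matrix.star_eq_conjTranspose, actOn_conjTranspose, actOn_mul]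
    have := Matrix.mem_unitaryGroup_iff.1 hA.1
    rw [Matrix.star_eq_conjTranspose] at this
    rw [this, actOn_one]
  obtain ⟨r, hr⟩ := hA.2 fun q => p q
  -- a Pauli string is a product of a part on `m` and a part off `m`, which commutes with the gate
  have split (q : Fin n → Fin 4) : pauliString q =
      _root_.actOn m (pauliString fun v : m => q v) *
        tensorMatrix fun v => if v ∈ m then 1 else pauliMatrix (q v) := by
    have e := actOn_tensorMatrix m (fun v => if v ∈ m then pauliMatrix (q v) else 1)
      (fun v hv => if_neg hv)
    have e' : (fun v : m => if (v : Fin n) ∈ m then pauliMatrix (q v) else 1) =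
        fun v : m => pauliMatrix (q v) := funext fun v => if_pos v.2
    rw [e'] at e
    rw [pauliString_eq_tensorMatrix, pauliString_eq_tensorMatrix, e, tensorMatrix_mul]
    congr 1
    funext v
    split_ifs <;> simp
  have hc := actOn_commute_tensorMatrix m Aᴴ
    (fun v => if v ∈ m then 1 else pauliMatrix (p v)) (fun q hq => if_pos hq)
  have key : _root_.actOn m A * pauliString p * (_root_.actOn m A)ᴴ =
      _root_.actOn m (A * (pauliString fun v : m => p v) * Aᴴ) *
        tensorMatrix fun v => if v ∈ m then 1 else pauliMatrix (p v) := by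
    rw [split p, actOn_conjTranspose, Matrix.mul_assoc, Matrix.mul_assoc, ← hc.eq,
      ← Matrix.mul_assoc, ← Matrix.mul_assoc, actOn_mul, actOn_mul]
  refine ⟨fun v => if h : v ∈ m then r ⟨v, h⟩ else p v, ?_⟩
  have e1 : (fun v : m => if h : (v : Fin n) ∈ m then r ⟨v, h⟩ else p v) = r :=
    funext fun v => dif_pos v.2
  have e2 : (fun v => if v ∈ m then (1 : Matrix Bool Bool ℂ) else
      pauliMatrix (if h : v ∈ m then r ⟨v, h⟩ else p v)) =
      fun v => if v ∈ m then 1 else pauliMatrix (p v) := by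
    funext v
    split_ifs <;> rfl
  rw [key, split fun v => if h : v ∈ m then r ⟨v, h⟩ else p v]
  simp only [e1, e2]
  rcases hr with hr | hr <;> rw [hr]
  · exact Or.inl rfl
  · right
    rw [actOn_neg, Matrix.neg_mul]

/-! ### One-qubit Clifford unitaries -/

/-- `M` is a one-qubit Clifford unitary, as a matrix with indices in `Bool`. -/
def IsQubitClifford (M : Matrix Bool Bool ℂ) : Prop :=
  M ∈ Matrix.unitaryGroup Bool ℂ ∧
    ∀ j : Fin 4, ∃ i : Fin 4, M * pauliMatrix j * Mᴴ = pauliMatrix i ∨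
      M * pauliMatrix j * Mᴴ = -pauliMatrix i

/-- A matrix on a register of one qubit, with indices in `Unit → Bool`, as a matrix with indices in
`Bool`. -/
def toQubit (A : Matrix (Unit → Bool) (Unit → Bool) ℂ) : Matrix Bool Bool ℂ :=
  fun a b => A (fun _ => a) (fun _ => b)

theorem tensorMatrix_toQubit (A : Matrix (Unit → Bool) (Unit → Bool) ℂ) :
    tensorMatrix (fun _ : Unit => toQubit A) = A := by
  ext x y
  simp [tensorMatrix, toQubit]

theorem tensorMatrix_unit_injective {M N : Matrix Bool Bool ℂ}
    (h : tensorMatrix (fun _ : Unit => M) = tensorMatrix fun _ : Unit => N) : M = N := by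
  ext a b
  simpa [tensorMatrix] using congrFun (congrFun h fun _ => a) fun _ => b

theorem IsQubitClifford.one : IsQubitClifford 1 :=
  ⟨one_mem _, fun j => ⟨j, Or.inl (by simp)⟩⟩

theorem IsClifford.toQubit {A : Matrix (Unit → Bool) (Unit → Bool) ℂ} (hA : IsClifford A) :
    IsQubitClifford (toQubit A) := by
  refine ⟨?_, fun j => ?_⟩
  · rw [Matrix.mem_unitaryGroup_iff]
    refine tensorMatrix_unit_injective ?_
    have := Matrix.mem_unitaryGroup_iff.1 hA.1
    rw [Matrix.star_eq_conjTranspose] at this ⊢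
    rw [← tensorMatrix_mul, ← tensorMatrix_conjTranspose, tensorMatrix_toQubit, this,
      tensorMatrix_one]
  · obtain ⟨q, hq⟩ := hA.2 fun _ => j
    refine ⟨q (), ?_⟩
    have e : pauliString q = tensorMatrix fun _ : Unit => pauliMatrix (q ()) := rfl
    have e' : pauliString (fun _ : Unit => j) = tensorMatrix fun _ => pauliMatrix j := rfl
    have e'' : -tensorMatrix (fun _ : Unit => pauliMatrix (q ())) =
        tensorMatrix fun _ : Unit => -pauliMatrix (q ()) := by
      ext x y; simp [tensorMatrix]
    rcases hq with hq | hq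
    · left
      refine tensorMatrix_unit_injective ?_
      rw [← e, ← hq, ← tensorMatrix_mul, ← tensorMatrix_mul, ← tensorMatrix_conjTranspose,
        tensorMatrix_toQubit, e']
    · right
      refine tensorMatrix_unit_injective ?_
      rw [← e'', ← e, ← hq, ← tensorMatrix_mul, ← tensorMatrix_mul, ← tensorMatrix_conjTranspose,
        tensorMatrix_toQubit, e']

theorem isClifford_tensorMatrix {ι : Type} [Fintype ι] [DecidableEq ι]
    {M : ι → Matrix Bool Bool ℂ} (hM : ∀ q, IsQubitClifford (M q)) :
    IsClifford (tensorMatrix M) := by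
  refine ⟨tensorMatrix_mem_unitaryGroup fun q => (hM q).1, fun p => ?_⟩
  have h (q : ι) : ∃ (i : Fin 4) (c : ℂ), (c = 1 ∨ c = -1) ∧
      M q * pauliMatrix (p q) * (M q)ᴴ = c • pauliMatrix i := by
    obtain ⟨i, hi | hi⟩ := (hM q).2 (p q)
    · exact ⟨i, 1, Or.inl rfl, by rw [hi, one_smul]⟩
    · exact ⟨i, -1, Or.inr rfl, by rw [hi, neg_one_smul]⟩
  choose r c hc hr using h
  refine ⟨r, ?_⟩
  have hprod : (∏ q, c q) = 1 ∨ (∏ q, c q) = -1 := by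
    refine Finset.prod_induction c (fun x => x = 1 ∨ x = -1) ?_ (Or.inl rfl) fun q _ => hc q
    rintro a b (rfl | rfl) (rfl | rfl) <;> simp
  rw [pauliString_eq_tensorMatrix, tensorMatrix_conjTranspose, tensorMatrix_mul, tensorMatrix_mul,
    funext hr, tensorMatrix_smul, ← pauliString_eq_tensorMatrix]
  rcases hprod with h | h <;> rw [h] <;> simp

theorem IsQubitClifford.mul {M N : Matrix Bool Bool ℂ} (hM : IsQubitClifford M)
    (hN : IsQubitClifford N) : IsQubitClifford (M * N) := by
  have h : IsClifford (tensorMatrix (fun _ : Unit => M) * tensorMatrix fun _ : Unit => N) :=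
    (isClifford_tensorMatrix fun _ => hM).mul (isClifford_tensorMatrix fun _ => hN)
  rw [tensorMatrix_mul] at h
  have h' := h.toQubit
  have e : _root_.toQubit (tensorMatrix fun _ : Unit => M * N) = M * N :=
    tensorMatrix_unit_injective (tensorMatrix_toQubit _)
  rwa [e] at h'

/-- The matrix `M` on the qubit `v`, and the identity on the other qubits. -/
def onQubit {ι : Type} [Fintype ι] [DecidableEq ι] (v : ι) (M : Matrix Bool Bool ℂ) :
    Matrix (ι → Bool) (ι → Bool) ℂ :=
  tensorMatrix (Function.update (fun _ => 1) v M)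

/-! ### Multiplying the last gate on a qubit by a one-qubit Clifford gate -/

section LeftMul

variable {ι : Type} [Fintype ι] [DecidableEq ι]

/-- Left multiplication of Clifford gates by a Clifford unitary. -/
def cliffordLeftMul (G : CliffordUnitary ι) : CliffordGate ι → CliffordGate ι :=
  Quotient.map (fun A => ⟨G.1 * A.1, G.2.mul A.2⟩) (by
    rintro A B ⟨z, hz, h⟩
    exact ⟨z, hz, by simp only [h, Matrix.mul_smul]⟩)

theorem cliffordLeftMul_injective (G : CliffordUnitary ι) :
    Function.Injective (cliffordLeftMul G) := by
  intro g g'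
  refine Quotient.inductionOn₂ g g' fun A B h => ?_
  obtain ⟨z, hz, h⟩ := Quotient.exact h
  have hU : (G.1)ᴴ * G.1 = 1 := Matrix.mem_unitaryGroup_iff'.1 G.2.1
  refine Quotient.sound ⟨z, hz, ?_⟩
  have h : G.1 * A.1 = z • (G.1 * B.1) := h
  calc A.1 = (G.1)ᴴ * (G.1 * A.1) := by rw [← Matrix.mul_assoc, hU, Matrix.one_mul]
    _ = z • B.1 := by
      rw [h, Matrix.mul_smul, ← Matrix.mul_assoc, hU, Matrix.one_mul]

theorem out_cliffordLeftMul (G : CliffordUnitary ι) (g : CliffordGate ι) :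
    ∃ z : ℂ, ‖z‖ = 1 ∧
      (Quotient.out (cliffordLeftMul G g)).1 = z • (G.1 * (Quotient.out g).1) := by
  have h : Quotient.mk _ (Quotient.out (cliffordLeftMul G g)) =
      Quotient.mk (phaseSetoid ι) ⟨G.1 * (Quotient.out g).1, G.2.mul (Quotient.out g).2⟩ := by
    rw [Quotient.out_eq]
    conv_lhs => rw [← Quotient.out_eq g]
    rfl
  exact Quotient.exact h

end LeftMul

/-- In a product of operators, a factor `L` at position `w` that commutes with all later operators
can be moved to the end. -/
theorem reverse_prod_ofFn_of_commute {A : Type*} [Ring A] [Algebra ℂ A] {N : ℕ} (f g : Fin N → A)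
    (w : Fin N) (L : A) (z : ℂ) (hw : g w = z • (L * f w)) (hne : ∀ j, j ≠ w → g j = f j)
    (hc : ∀ j, w < j → Commute (f j) L) :
    (List.ofFn g).reverse.prod = z • (L * (List.ofFn f).reverse.prod) := by
  induction N with
  | zero => exact w.elim0
  | succ N ih =>
    simp only [List.ofFn_succ', List.concat_eq_append, List.reverse_append, List.reverse_singleton,
      List.singleton_append, List.prod_cons]
    induction w using Fin.lastCases with
    | last =>
      have : (fun i : Fin N => g i.castSucc) = fun i => f i.castSucc :=
        funext fun i => hne _ (Fin.castSucc_lt_last i).ne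
      rw [this, hw, smul_mul_assoc, mul_assoc]
    | cast w =>
      rw [ih (fun i => f i.castSucc) (fun i => g i.castSucc) w hw
        (fun j hj => hne _ fun h => hj (Fin.castSucc_injective _ h))
        (fun j hj => hc _ (Fin.castSucc_lt_castSucc_iff.2 hj)),
        hne _ (Fin.castSucc_lt_last w).ne', mul_smul_comm, ← mul_assoc, ← mul_assoc,
        (hc _ (Fin.castSucc_lt_last w)).eq]

section Rotate

variable {n : ℕ} (T : CircuitTemplate n)

/-- The gate `w` is the last one that acts on the qubit `q`. -/
def IsLastGate (q : Fin n) (w : Fin T.R) : Prop :=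
  q ∈ T.supp w ∧ ∀ j, w < j → q ∉ T.supp j

theorem exists_isLastGate {q : Fin n} (h : ∃ w, q ∈ T.supp w) : ∃ w, IsLastGate T q w := by
  classical
  obtain ⟨w, hw⟩ := h
  have hne : (Finset.univ.filter fun w => q ∈ T.supp w).Nonempty := ⟨w, by simpa using hw⟩
  refine ⟨_, by simpa using Finset.max'_mem _ hne, fun j hj hq => ?_⟩
  exact absurd (Finset.le_max' _ j (by simpa using hq)) (not_le.2 hj)

theorem isClifford_circuitUnitary (U : T.Gates) : IsClifford (circuitUnitary T U) := by
  refine IsClifford.list_prod fun A hA => ?_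
  rw [List.mem_reverse, List.mem_ofFn] at hA
  obtain ⟨w, rfl⟩ := hA
  exact (Quotient.out (U w)).2.actOn

theorem outputState_ne_zero (U : T.Gates) : outputState T U ≠ 0 := by
  intro h
  have hU : (circuitUnitary T U)ᴴ * circuitUnitary T U = 1 :=
    Matrix.mem_unitaryGroup_iff'.1 (isClifford_circuitUnitary T U).1
  have h1 := congrArg (fun ψ => (circuitUnitary T U)ᴴ *ᵥ ψ) h
  simp only [outputState, Matrix.mulVec_mulVec, hU, Matrix.one_mulVec, Matrix.mulVec_zero] at h1
  simpa using congrFun h1 fun _ => false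

/-- A qubit on which no gate acts stays in the state `|0⟩`. -/
theorem onQubit_pauliZ_mulVec_outputState {q : Fin n} (hq : ∀ w, q ∉ T.supp w) (U : T.Gates) :
    onQubit q (pauliMatrix 3) *ᵥ outputState T U = outputState T U := by
  have hc : Commute (onQubit q (pauliMatrix 3)) (circuitUnitary T U) := by
    refine Commute.list_prod_right _ _ fun A hA => ?_
    rw [List.mem_reverse, List.mem_ofFn] at hA
    obtain ⟨w, rfl⟩ := hA
    refine (actOn_commute_tensorMatrix _ _ _ fun v hv => ?_).symm
    rw [Function.update_of_ne]
    rintro rfl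
    exact hq w hv
  rw [outputState, Matrix.mulVec_mulVec, hc.eq, ← Matrix.mulVec_mulVec]
  congr 1
  ext x
  rw [Matrix.mulVec_single_one]
  simp only [Matrix.col_apply, onQubit, tensorMatrix]
  rcases eq_or_ne x (fun _ => false) with rfl | hx
  · rw [Pi.single_eq_same]
    refine Finset.prod_eq_one fun v _ => ?_
    by_cases h : v = q
    · subst h; simp [pauliMatrix_three_apply]
    · simp [h]
  · rw [Pi.single_eq_of_ne hx]
    obtain ⟨v, hv⟩ := Function.ne_iff.1 hx
    refine Finset.prod_eq_zero (Finset.mem_univ v) ?_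
    by_cases h : v = q
    · subst h; simp [pauliMatrix_three_apply, hv]
    · simp [h, hv]

theorem isClifford_tensorMatrix_update {ι : Type} [Fintype ι] (e : ι → Fin n) [DecidableEq ι]
    (q : Fin n) {M : Matrix Bool Bool ℂ} (hM : IsQubitClifford M) :
    IsClifford
      (tensorMatrix fun v : ι => (Function.update (fun _ => 1) q M : Fin n → _) (e v)) := by
  refine isClifford_tensorMatrix fun v => ?_
  by_cases h : e v = q
  · simpa [h] using hM
  · simpa [h] using IsQubitClifford.one

/-- The circuit in which the gate `w` is followed by the one-qubit Clifford gate `V` on the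
qubit `q`. -/
noncomputable def rotateGate (w : Fin T.R) (q : Fin n) (V : CliffordGate Unit) (U : T.Gates) :
    T.Gates :=
  Function.update U w (cliffordLeftMul
    ⟨_, isClifford_tensorMatrix_update (Subtype.val : T.supp w → Fin n) q
      (Quotient.out V).2.toQubit⟩ (U w))

theorem rotateGate_injective (w : Fin T.R) (q : Fin n) (V : CliffordGate Unit) :
    Function.Injective (rotateGate T w q V) := by
  intro U U' h
  funext j
  have hj := congrFun h j
  by_cases hjw : j = w
  · subst hjw
    simp only [rotateGate, Function.update_self] at hj
    exact cliffordLeftMul_injective _ hj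
  · simpa [rotateGate, hjw] using hj

theorem outputState_rotateGate {w : Fin T.R} {q : Fin n} (hw : IsLastGate T q w)
    (V : CliffordGate Unit) (U : T.Gates) :
    ∃ z : ℂ, z ≠ 0 ∧ outputState T (rotateGate T w q V U) =
      z • (onQubit q (toQubit (Quotient.out V).1) *ᵥ outputState T U) := by
  obtain ⟨z, hz, h⟩ := out_cliffordLeftMul
    ⟨_, isClifford_tensorMatrix_update (Subtype.val : T.supp w → Fin n) q
      (Quotient.out V).2.toQubit⟩ (U w)
  refine ⟨z, fun h0 => by simp [h0] at hz, ?_⟩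
  have key : circuitUnitary T (rotateGate T w q V U) =
      z • (onQubit q (toQubit (Quotient.out V).1) * circuitUnitary T U) := by
    refine reverse_prod_ofFn_of_commute _ _ w _ z ?_ (fun j hj => ?_) fun j hj => ?_
    · simp only [rotateGate, Function.update_self]
      rw [h, actOn_smul, ← actOn_mul, actOn_tensorMatrix]
      · rfl
      · intro v hv
        rw [Function.update_of_ne]
        rintro rfl
        exact hv hw.1
    · simp [rotateGate, hj]
    · refine actOn_commute_tensorMatrix _ _ _ fun v hv => ?_
      rw [Function.update_of_ne]
      rintro rfl
      exact hw.2 j hj hv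
  rw [outputState, key, Matrix.smul_mulVec, ← Matrix.mulVec_mulVec, outputState]

/-- One-qubit matrices `M a` at the qubits `t a` of a triple, and the identity elsewhere. -/
noncomputable def onTriple (t : Fin 3 ↪ Fin n) (M : Fin 3 → Matrix Bool Bool ℂ) :
    Fin n → Matrix Bool Bool ℂ :=
  Function.extend t M fun _ => 1

theorem onTriple_apply (t : Fin 3 ↪ Fin n) (M : Fin 3 → Matrix Bool Bool ℂ) (a : Fin 3) :
    onTriple t M (t a) = M a := t.injective.extend_apply _ _ _

theorem onTriple_apply_of_notMem (t : Fin 3 ↪ Fin n) (M : Fin 3 → Matrix Bool Bool ℂ) {v : Fin n}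
    (hv : v ∉ Set.range t) : onTriple t M v = 1 :=
  Function.extend_apply' _ _ _ fun ⟨a, ha⟩ => hv ⟨a, ha⟩

theorem onQubit_mul_eq_onTriple (t : Fin 3 ↪ Fin n) (M : Fin 3 → Matrix Bool Bool ℂ) :
    onQubit (t 2) (M 2) * (onQubit (t 1) (M 1) * onQubit (t 0) (M 0)) =
      tensorMatrix (onTriple t M) := by
  rw [onQubit, onQubit, onQubit, tensorMatrix_mul, tensorMatrix_mul]
  congr 1
  funext v
  by_cases hv : v ∈ Set.range t
  · obtain ⟨a, rfl⟩ := hv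
    rw [onTriple_apply]
    fin_cases a <;> simp [t.injective.eq_iff]
  · have h (a : Fin 3) : v ≠ t a := fun h => hv ⟨a, h.symm⟩
    simp [onTriple_apply_of_notMem t M hv, h]

theorem onTriple_mul (t : Fin 3 ↪ Fin n) (M N : Fin 3 → Matrix Bool Bool ℂ) :
    tensorMatrix (onTriple t M) * tensorMatrix (onTriple t N) =
      tensorMatrix (onTriple t fun a => M a * N a) := by
  rw [tensorMatrix_mul]
  congr 1
  funext v
  by_cases hv : v ∈ Set.range t
  · obtain ⟨a, rfl⟩ := hv
    simp [onTriple_apply]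
  · simp [onTriple_apply_of_notMem _ _ hv]

theorem tensorMatrix_onTriple_smul (t : Fin 3 ↪ Fin n) (c : Fin 3 → ℂ)
    (M : Fin 3 → Matrix Bool Bool ℂ) :
    tensorMatrix (onTriple t fun a => c a • M a) =
      (∏ a, c a) • tensorMatrix (onTriple t M) := by
  have h : onTriple t (fun a => c a • M a) =
      fun v => Function.extend t c (fun _ => 1) v • onTriple t M v := by
    funext v
    by_cases hv : v ∈ Set.range t
    · obtain ⟨a, rfl⟩ := hv
      simp [onTriple_apply, t.injective.extend_apply]
    · rw [onTriple_apply_of_notMem _ _ hv, onTriple_apply_of_notMem _ _ hv,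
        Function.extend_apply' _ _ _ fun ⟨a, ha⟩ => hv ⟨a, ha⟩, one_smul]
  rw [h, tensorMatrix_smul]
  congr 1
  refine (Fintype.prod_of_injective t t.injective _ _ (fun v hv => ?_) fun a => ?_).symm
  · exact Function.extend_apply' _ _ _ fun ⟨a, ha⟩ => hv ⟨a, ha⟩
  · exact (t.injective.extend_apply _ _ _).symm

/-- The circuit in which the gates `w a` are followed by the one-qubit Clifford gates `V a` on the
qubits `t a`. -/
noncomputable def rotateTriple (w : Fin 3 → Fin T.R) (t : Fin 3 ↪ Fin n)
    (V : Fin 3 → CliffordGate Unit) (U : T.Gates) : T.Gates :=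
  rotateGate T (w 2) (t 2) (V 2) (rotateGate T (w 1) (t 1) (V 1)
    (rotateGate T (w 0) (t 0) (V 0) U))

theorem rotateTriple_injective (w : Fin 3 → Fin T.R) (t : Fin 3 ↪ Fin n)
    (V : Fin 3 → CliffordGate Unit) : Function.Injective (rotateTriple T w t V) :=
  (rotateGate_injective T _ _ _).comp
    ((rotateGate_injective T _ _ _).comp (rotateGate_injective T _ _ _))

theorem rotateTriple_apply_congr {w : Fin 3 → Fin T.R} (t : Fin 3 ↪ Fin n)
    {V V' : Fin 3 → CliffordGate Unit} (U : T.Gates) {j : Fin T.R}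
    {a : Fin 3} (hV : V a = V' a) (hj : ∀ b, b ≠ a → j ≠ w b) :
    rotateTriple T w t V U j = rotateTriple T w t V' U j := by
  have off (b : Fin 3) (hb : b ≠ a) (v : CliffordGate Unit) (U' : T.Gates) :
      rotateGate T (w b) (t b) v U' j = U' j := Function.update_of_ne (hj b hb) _ _
  have on (v : CliffordGate Unit) (U' U'' : T.Gates) (h : U' j = U'' j) :
      rotateGate T (w a) (t a) v U' j = rotateGate T (w a) (t a) v U'' j := by
    by_cases h' : j = w a
    · subst h'; simp [rotateGate, h]
    · simp [rotateGate, h', h]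
  unfold rotateTriple
  fin_cases a
  · rw [off 2 (by decide), off 2 (by decide), off 1 (by decide), off 1 (by decide)]
    exact congrArg (fun v => rotateGate T (w 0) (t 0) v U j) hV
  · rw [off 2 (by decide), off 2 (by decide)]
    refine (congrArg (fun v => rotateGate T (w 1) (t 1) v _ j) hV).trans (on _ _ _ ?_)
    rw [off 0 (by decide), off 0 (by decide)]
  · refine (congrArg (fun v => rotateGate T (w 2) (t 2) v _ j) hV).trans (on _ _ _ ?_)
    rw [off 1 (by decide), off 1 (by decide), off 0 (by decide), off 0 (by decide)]

/-- A one-qubit Clifford unitary as a Clifford gate on a register of one qubit. -/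
noncomputable def qubitGate (M : Matrix Bool Bool ℂ) (hM : IsQubitClifford M) :
    CliffordGate Unit :=
  Quotient.mk _ ⟨tensorMatrix fun _ => M, isClifford_tensorMatrix fun _ => hM⟩

theorem toQubit_out_qubitGate {M : Matrix Bool Bool ℂ} (hM : IsQubitClifford M) :
    ∃ z : ℂ, z ≠ 0 ∧ toQubit (Quotient.out (qubitGate M hM)).1 = z • M := by
  obtain ⟨z, hz, h⟩ := Quotient.exact (Quotient.out_eq (qubitGate M hM))
  refine ⟨z, fun h0 => by simp [h0] at hz, ?_⟩
  rw [h]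
  ext a b
  simp [toQubit, tensorMatrix]

theorem outputState_rotateTriple {w : Fin 3 → Fin T.R} {t : Fin 3 ↪ Fin n}
    (hw : ∀ a, IsLastGate T (t a) (w a)) {M : Fin 3 → Matrix Bool Bool ℂ}
    (hM : ∀ a, IsQubitClifford (M a)) (U : T.Gates) :
    ∃ z : ℂ, z ≠ 0 ∧ outputState T (rotateTriple T w t (fun a => qubitGate (M a) (hM a)) U) =
      z • (tensorMatrix (onTriple t M) *ᵥ outputState T U) := by
  choose c hc hcM using fun a => toQubit_out_qubitGate (hM a)
  obtain ⟨z0, hz0, h0⟩ := outputState_rotateGate T (hw 0) (qubitGate (M 0) (hM 0)) U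
  obtain ⟨z1, hz1, h1⟩ := outputState_rotateGate T (hw 1) (qubitGate (M 1) (hM 1))
    (rotateGate T (w 0) (t 0) (qubitGate (M 0) (hM 0)) U)
  obtain ⟨z2, hz2, h2⟩ := outputState_rotateGate T (hw 2) (qubitGate (M 2) (hM 2))
    (rotateGate T (w 1) (t 1) (qubitGate (M 1) (hM 1))
      (rotateGate T (w 0) (t 0) (qubitGate (M 0) (hM 0)) U))
  refine ⟨z2 * (z1 * z0) * ∏ a, c a, mul_ne_zero (mul_ne_zero hz2 (mul_ne_zero hz1 hz0))
    (Finset.prod_ne_zero_iff.2 fun a _ => hc a), ?_⟩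
  have e : (∏ a, c a) • (tensorMatrix (onTriple t M) *ᵥ outputState T U) =
      tensorMatrix (onTriple t fun a => toQubit (Quotient.out (qubitGate (M a) (hM a))).1) *ᵥ
        outputState T U := by
    rw [funext hcM, tensorMatrix_onTriple_smul, Matrix.smul_mulVec]
  rw [rotateTriple, h2, h1, h0, mul_smul, e, ← onQubit_mul_eq_onTriple]
  simp only [Matrix.mulVec_smul, smul_smul, Matrix.mulVec_mulVec]

end Rotate

/-! ### Post-measurement states of a triple -/

section Projected

variable {n : ℕ} (t : Fin 3 ↪ Fin n)

theorem extend_comp_self (z : Fin n → Bool) : Function.extend t (z ∘ t) z = z := by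
  funext v
  by_cases hv : ∃ a, t a = v
  · obtain ⟨a, rfl⟩ := hv
    exact t.injective.extend_apply _ _ _
  · exact Function.extend_apply' _ _ _ hv

theorem extend_triple_injective (x : Fin n → Bool) :
    Function.Injective fun y : Fin 3 → Bool => Function.extend t y x := by
  intro y y' h
  funext a
  simpa [t.injective.extend_apply] using congrFun h (t a)

theorem exists_ne_of_notMem_range_extend {x z : Fin n → Bool}
    (hz : z ∉ Set.range fun y : Fin 3 → Bool => Function.extend t y x) :
    ∃ v, v ∉ Set.range t ∧ z v ≠ x v := by
  by_contra! h
  refine hz ⟨z ∘ t, ?_⟩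
  refine Eq.trans ?_ (extend_comp_self t z)
  funext v
  by_cases hv : v ∈ Set.range t
  · obtain ⟨a, rfl⟩ := hv
    simp [t.injective.extend_apply]
  · have hv' : ¬ ∃ a, t a = v := hv
    simp only [Function.extend_apply' _ _ _ hv', h v hv]

/-- Measuring the qubits outside the triple commutes with an operator that is a tensor product, and
is diagonal with entry `1` at the outcome `x` on the measured qubits. -/
theorem projectedState_tensorMatrix_mulVec (x : Fin n → Bool) (M : Fin 3 → Matrix Bool Bool ℂ)
    (N : Fin n → Matrix Bool Bool ℂ) (hN : ∀ a, N (t a) = M a)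
    (hdiag : ∀ v, v ∉ Set.range t → ∀ b, b ≠ x v → N v (x v) b = 0)
    (hone : ∀ v, v ∉ Set.range t → N v (x v) (x v) = 1) (ψ : (Fin n → Bool) → ℂ) :
    projectedState (tensorMatrix N *ᵥ ψ) t x = tensorMatrix M *ᵥ projectedState ψ t x := by
  funext y
  simp only [projectedState, Matrix.mulVec, dotProduct]
  refine (Fintype.sum_of_injective _ (extend_triple_injective t x) _ _ (fun z hz => ?_)
    fun y' => ?_).symm
  · obtain ⟨v, hv, hne⟩ := exists_ne_of_notMem_range_extend t hz
    have : tensorMatrix N (Function.extend t y x) z = 0 := by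
      refine Finset.prod_eq_zero (Finset.mem_univ v) ?_
      rw [Function.extend_apply' _ _ _ hv]
      exact hdiag v hv _ hne
    rw [this, zero_mul]
  · congr 1
    refine Fintype.prod_of_injective t t.injective _ _ (fun v hv => ?_) fun a => ?_
    · rw [Function.extend_apply' _ _ _ hv, Function.extend_apply' _ _ _ hv]
      exact hone v hv
    · rw [t.injective.extend_apply, t.injective.extend_apply, hN]

theorem projectedState_onTriple_mulVec (x : Fin n → Bool) (M : Fin 3 → Matrix Bool Bool ℂ)
    (ψ : (Fin n → Bool) → ℂ) :
    projectedState (tensorMatrix (onTriple t M) *ᵥ ψ) t x =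
      tensorMatrix M *ᵥ projectedState ψ t x := by
  refine projectedState_tensorMatrix_mulVec t x M _ (onTriple_apply t M) (fun v hv b hb => ?_)
    (fun v hv => ?_) ψ
  · rw [onTriple_apply_of_notMem t M hv, Matrix.one_apply_ne hb.symm]
  · rw [onTriple_apply_of_notMem t M hv, Matrix.one_apply_eq]

/-- The expectation of a three-qubit operator in a post-measurement state is the expectation, in
the full state, of its product with the projection to the measurement outcome. -/
theorem expectation_projectedState (x : Fin n → Bool) (M : Fin 3 → Matrix Bool Bool ℂ)
    (ψ : (Fin n → Bool) → ℂ) :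
    star ψ ⬝ᵥ (tensorMatrix (Function.extend t M
      fun v => Matrix.diagonal fun b => if b = x v then 1 else 0) *ᵥ ψ) =
      star (projectedState ψ t x) ⬝ᵥ (tensorMatrix M *ᵥ projectedState ψ t x) := by
  rw [← projectedState_tensorMatrix_mulVec t x M (Function.extend t M
    fun v => Matrix.diagonal fun b => if b = x v then 1 else 0)
    (fun a => t.injective.extend_apply _ _ _)]
  · simp only [dotProduct]
    refine (Fintype.sum_of_injective _ (extend_triple_injective t x) _ _ (fun z hz => ?_)
      fun y' => rfl).symm
    obtain ⟨v, hv, hne⟩ := exists_ne_of_notMem_range_extend t hz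
    rw [mul_eq_zero]
    right
    refine Finset.sum_eq_zero fun z' _ => ?_
    rw [mul_eq_zero]
    left
    refine Finset.prod_eq_zero (Finset.mem_univ v) ?_
    rw [Function.extend_apply' _ _ _ hv, Matrix.diagonal_apply]
    simp [hne]
  · intro v hv b hb
    rw [Function.extend_apply' _ _ _ hv, Matrix.diagonal_apply_ne _ hb.symm]
  · intro v hv
    rw [Function.extend_apply' _ _ _ hv, Matrix.diagonal_apply_eq, if_pos rfl]

theorem ghzState_eq : ghzState =
    ((1 / √2 : ℝ) : ℂ) • (Pi.single (fun _ => false) 1 + Pi.single (fun _ => true) 1) := by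
  have hne : (fun _ : Fin 3 => false) ≠ fun _ => true := fun h => by
    simpa using congrFun h 0
  funext y
  by_cases h : y = fun _ => false
  · subst h; simp [ghzState, Pi.single_eq_of_ne hne]
  · by_cases h' : y = fun _ => true
    · subst h'; simp [ghzState, Pi.single_eq_of_ne hne.symm]
    · simp [ghzState, h, h', Pi.single_eq_of_ne]

theorem one_div_sqrt_two_ne_zero : ((1 / √2 : ℝ) : ℂ) ≠ 0 := by
  rw [Complex.ofReal_ne_zero]; positivity

/-- If a triple exhibits GHZ-type MIE, then in suitable local Clifford frames some
post-measurement state of the triple is a multiple of the GHZ state. -/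
theorem exists_frame_of_hasGHZTypeMIE {ψ : (Fin n → Bool) → ℂ} (hψ : ψ ≠ 0)
    (h : HasGHZTypeMIE ψ t) :
    ∃ (x : Fin n → Bool) (M : Fin 3 → Matrix Bool Bool ℂ) (μ : ℂ),
      (∀ a, IsQubitClifford (M a)) ∧ μ ≠ 0 ∧
        projectedState (tensorMatrix (onTriple t M) *ᵥ ψ) t x = μ • ghzState := by
  obtain ⟨x, hx⟩ := Function.ne_iff.1 hψ
  have hne : projectedState ψ t x ≠ 0 := by
    intro h0
    have := congrFun h0 (x ∘ t)
    rw [projectedState, extend_comp_self] at this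
    exact hx this
  obtain ⟨C, hC, hghz⟩ := h x hne
  have e : tensorThree C = tensorMatrix fun a => toQubit (C a) := rfl
  rw [e, Matrix.mulVec_smul] at hghz
  have hN : ((√(∑ y, ‖projectedState ψ t x y‖ ^ 2) : ℝ) : ℂ) ≠ 0 := by
    intro h0
    rw [h0, inv_zero, zero_smul] at hghz
    have := congrFun hghz fun _ => false
    have h1 : ghzState (fun _ => false) = ((1 / √2 : ℝ) : ℂ) := by simp [ghzState]
    rw [h1] at this
    exact one_div_sqrt_two_ne_zero this.symm
  refine ⟨x, fun a => toQubit (C a), _, fun a => (hC a).toQubit, hN, ?_⟩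
  rw [projectedState_onTriple_mulVec, ← hghz, smul_smul, mul_inv_cancel₀ hN, one_smul]

theorem onQubit_mulVec_ghzState_apply (a : Fin 3) (N : Matrix Bool Bool ℂ) (b : Bool) :
    (onQubit a N *ᵥ ghzState) (fun _ => b) = N b b * ((1 / √2 : ℝ) : ℂ) := by
  have h (c : Bool) : onQubit a N (fun _ => b) (fun _ => c) = if b = c then N b b else 0 := by
    split_ifs with hbc
    · subst hbc
      simp only [onQubit, tensorMatrix]
      rw [Finset.prod_eq_single a] <;> simp +contextual
    · obtain ⟨v, hv⟩ := exists_ne a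
      unfold onQubit tensorMatrix
      refine Finset.prod_eq_zero (Finset.mem_univ v) ?_
      simp [hv, hbc]
  rw [ghzState_eq, Matrix.mulVec_smul, Matrix.mulVec_add, Matrix.mulVec_single_one,
    Matrix.mulVec_single_one]
  simp only [Pi.smul_apply, Pi.add_apply, Matrix.col_apply, h, smul_eq_mul]
  cases b <;> simp [mul_comm]

/-- The reduced state of each qubit of a GHZ-type state is maximally mixed, so no qubit of a triple
that exhibits GHZ-type MIE is in the state `|0⟩`. -/
theorem onQubit_pauliZ_mulVec_ne {ψ : (Fin n → Bool) → ℂ} {x : Fin n → Bool}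
    {M : Fin 3 → Matrix Bool Bool ℂ} {μ : ℂ} (hM : ∀ a, IsQubitClifford (M a)) (hμ : μ ≠ 0)
    (h : projectedState (tensorMatrix (onTriple t M) *ᵥ ψ) t x = μ • ghzState) (a : Fin 3) :
    onQubit (t a) (pauliMatrix 3) *ᵥ ψ ≠ ψ := by
  intro hZ
  have hU : (M a)ᴴ * M a = 1 := Matrix.mem_unitaryGroup_iff'.1 (hM a).1
  set N := M a * pauliMatrix 3 * (M a)ᴴ with hNdef
  have e1 : tensorMatrix (onTriple t M) * onQubit (t a) (pauliMatrix 3) =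
      onQubit (t a) N * tensorMatrix (onTriple t M) := by
    simp only [onQubit, tensorMatrix_mul]
    congr 1
    funext v
    by_cases hv : v = t a
    · subst hv
      simp only [onTriple_apply, Function.update_self, hNdef, Matrix.mul_assoc, hU, Matrix.mul_one]
    · simp [hv]
  have e2 : onQubit (t a) N = tensorMatrix (onTriple t (Function.update (fun _ => 1) a N)) := by
    rw [onQubit]
    congr 1
    funext v
    by_cases hv : v ∈ Set.range t
    · obtain ⟨c, rfl⟩ := hv
      simp only [onTriple_apply, Function.update_apply, t.injective.eq_iff]
    · rw [onTriple_apply_of_notMem _ _ hv, Function.update_of_ne]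
      rintro rfl
      exact hv ⟨a, rfl⟩
  have e3 : onQubit a N *ᵥ (μ • ghzState) = μ • ghzState := by
    rw [← h, onQubit, ← projectedState_onTriple_mulVec, ← e2, Matrix.mulVec_mulVec, ← e1,
      ← Matrix.mulVec_mulVec, hZ]
  rw [Matrix.mulVec_smul] at e3
  have e4 (b : Bool) : N b b = 1 := by
    have h1 := congrFun (smul_right_injective _ hμ e3) fun _ => b
    rw [onQubit_mulVec_ghzState_apply] at h1
    have h2 : ghzState (fun _ => b) = ((1 / √2 : ℝ) : ℂ) := by
      cases b <;> simp [ghzState]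
    rw [h2] at h1
    exact mul_right_cancel₀ one_div_sqrt_two_ne_zero (h1.trans (one_mul _).symm)
  have e5 : Matrix.trace N = 0 := by
    rw [hNdef, Matrix.trace_mul_comm, ← Matrix.mul_assoc, hU, Matrix.one_mul]
    simp [Matrix.trace, pauliMatrix_three_apply]
  simp [Matrix.trace, e4] at e5

end Projected

/-! ### Stabilizers -/

/-- The sign `(-1)^b`. -/
def boolSign (b : Bool) : ℂ := if b = true then -1 else 1

theorem pauliMatrix_three : pauliMatrix 3 = Matrix.diagonal boolSign := by
  ext a b
  by_cases h : a = b <;> simp [pauliMatrix_three_apply, boolSign, h]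

/-- In a stabilizer state, a Pauli string with a nonzero expectation is a stabilizer, up to
sign. -/
theorem pauliString_mulVec_of_expectation_ne_zero {ι : Type} [Fintype ι] [DecidableEq ι]
    {C : Matrix (ι → Bool) (ι → Bool) ℂ} (hC : IsClifford C) (p : ι → Fin 4)
    (h : star (C *ᵥ Pi.single (fun _ => false) 1) ⬝ᵥ
      (pauliString p *ᵥ (C *ᵥ Pi.single (fun _ => false) 1)) ≠ 0) :
    ∃ s : ℂ, s * s = 1 ∧ pauliString p *ᵥ (C *ᵥ Pi.single (fun _ => false) 1) =
      s • (C *ᵥ Pi.single (fun _ => false) 1) := by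
  have hU : C * Cᴴ = 1 := Matrix.mem_unitaryGroup_iff.1 hC.1
  obtain ⟨q, s, hs, hq⟩ : ∃ (q : ι → Fin 4) (s : ℂ), s * s = 1 ∧
      Cᴴ * pauliString p * C = s • pauliString q := by
    obtain ⟨q, hq⟩ := hC.conjTranspose.2 p
    rw [Matrix.conjTranspose_conjTranspose] at hq
    rcases hq with hq | hq
    · exact ⟨q, 1, by simp, by simpa using hq⟩
    · exact ⟨q, -1, by simp, by simpa using hq⟩
  have e1 : pauliString p * C = s • (C * pauliString q) := by
    rw [← Matrix.mul_smul, ← hq, ← Matrix.mul_assoc, ← Matrix.mul_assoc, hU, Matrix.one_mul]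
  have e2 : pauliString q (fun _ => false) (fun _ => false) ≠ 0 := by
    intro h0
    apply h
    rw [Matrix.star_mulVec, ← Matrix.dotProduct_mulVec, Matrix.mulVec_mulVec, Matrix.mulVec_mulVec,
      hq]
    simp [h0]
  have e3 : pauliString q *ᵥ Pi.single (fun _ => false) 1 =
      (Pi.single (fun _ => false) 1 : (ι → Bool) → ℂ) := by
    have hq03 (v : ι) : q v = 0 ∨ q v = 3 := by
      have hv := (Finset.prod_ne_zero_iff.1 e2) v (Finset.mem_univ v)
      generalize q v = j at hv
      fin_cases j <;> simp_all [pauliMatrix_one_apply, pauliMatrix_two_apply]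
    funext x
    rw [Matrix.mulVec_single_one, Matrix.col_apply]
    rcases eq_or_ne x (fun _ => false) with rfl | hx
    · rw [Pi.single_eq_same]
      refine Finset.prod_eq_one fun v _ => ?_
      rcases hq03 v with hv | hv <;> simp [hv, pauliMatrix_zero, pauliMatrix_three_apply]
    · rw [Pi.single_eq_of_ne hx]
      obtain ⟨v, hv⟩ := Function.ne_iff.1 hx
      refine Finset.prod_eq_zero (Finset.mem_univ v) ?_
      rcases hq03 v with h' | h' <;> simp [h', pauliMatrix_zero, pauliMatrix_three_apply, hv]
  refine ⟨s, hs, ?_⟩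
  rw [Matrix.mulVec_mulVec, e1, Matrix.smul_mulVec, ← Matrix.mulVec_mulVec, e3]

/-- If some post-measurement state of a triple in a stabilizer state is GHZ, then every Pauli string
with nonzero GHZ expectation extends to a stabilizer that is diagonal on the measured qubits. -/
theorem exists_stabilizer_of_projectedState_eq {n : ℕ} (t : Fin 3 ↪ Fin n)
    {C : Matrix (Fin n → Bool) (Fin n → Bool) ℂ} (hC : IsClifford C) {x : Fin n → Bool} {μ : ℂ}
    (hμ : μ ≠ 0)
    (h : projectedState (C *ᵥ Pi.single (fun _ => false) 1) t x = μ • ghzState)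
    (p : Fin 3 → Fin 4) (hp : star ghzState ⬝ᵥ (pauliString p *ᵥ ghzState) ≠ 0) :
    ∃ (q : Fin n → Fin 4) (s : ℂ), s * s = 1 ∧ (∀ a, q (t a) = p a) ∧
      (∀ v, v ∉ Set.range t → q v = 0 ∨ q v = 3) ∧
      pauliString q *ᵥ (C *ᵥ Pi.single (fun _ => false) 1) =
        s • (C *ᵥ Pi.single (fun _ => false) 1) := by
  classical
  set ψ : (Fin n → Bool) → ℂ := C *ᵥ Pi.single (fun _ => false) 1 with hψ
  -- expand the projections `|x v⟩⟨x v|` into the Pauli matrices `I` and `Z`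
  let S : Fin n → Finset (Fin 4) := Function.extend t (fun a => {p a}) fun _ => {0, 3}
  let c : Fin n → Fin 4 → ℂ := Function.extend t (fun _ _ => 1)
    fun v j => if j = 0 then 1 / 2 else boolSign (x v) / 2
  have hsum (v : Fin n) : (Function.extend t (fun a => pauliMatrix (p a))
      (fun v => Matrix.diagonal fun b => if b = x v then 1 else 0)) v =
      ∑ j ∈ S v, c v j • pauliMatrix j := by
    by_cases hv : ∃ a, t a = v
    · obtain ⟨a, rfl⟩ := hv
      simp [S, c, t.injective.extend_apply]
    · simp only [S, c, Function.extend_apply' _ _ _ hv]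
      rw [Finset.sum_pair (by decide), pauliMatrix_zero, pauliMatrix_three]
      ext a b
      by_cases hab : a = b
      · subst hab
        cases a <;> cases x v <;> simp [boolSign] <;> norm_num
      · simp [hab]
  have hexp : star ψ ⬝ᵥ (tensorMatrix (Function.extend t (fun a => pauliMatrix (p a))
      fun v => Matrix.diagonal fun b => if b = x v then 1 else 0) *ᵥ ψ) =
      ∑ q ∈ Fintype.piFinset S, (∏ v, c v (q v)) * (star ψ ⬝ᵥ (pauliString q *ᵥ ψ)) := by
    have : tensorMatrix (Function.extend t (fun a => pauliMatrix (p a))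
        fun v => Matrix.diagonal fun b => if b = x v then 1 else 0) =
        ∑ q ∈ Fintype.piFinset S, (∏ v, c v (q v)) • pauliString q := by
      ext y z
      simp only [tensorMatrix, hsum, Matrix.sum_apply, Matrix.smul_apply, pauliString]
      rw [Finset.prod_univ_sum]
      simp only [smul_eq_mul, Finset.prod_mul_distrib]
    rw [this, Matrix.sum_mulVec, dotProduct_sum]
    simp only [Matrix.smul_mulVec, dotProduct_smul, smul_eq_mul]
  rw [expectation_projectedState, h] at hexp
  have hne : star (μ • ghzState) ⬝ᵥ (tensorMatrix (fun a => pauliMatrix (p a)) *ᵥ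
      (μ • ghzState)) ≠ 0 := by
    rw [Matrix.mulVec_smul, star_smul, smul_dotProduct, dotProduct_smul]
    exact smul_ne_zero (star_ne_zero.2 hμ) (smul_ne_zero hμ hp)
  rw [hexp] at hne
  obtain ⟨q, hqS, hq⟩ := Finset.exists_ne_zero_of_sum_ne_zero hne
  obtain ⟨s, hs, hqs⟩ := pauliString_mulVec_of_expectation_ne_zero hC q (right_ne_zero_of_mul hq)
  rw [Fintype.mem_piFinset] at hqS
  refine ⟨q, s, hs, fun a => ?_, fun v hv => ?_, hqs⟩
  · simpa [S, t.injective.extend_apply] using hqS (t a)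
  · simpa [S, Function.extend_apply' _ _ _ hv] using hqS v

/-- The expectation of a Pauli string that has no diagonal entries is given by its two entries
between `|000⟩` and `|111⟩`. -/
theorem ghzState_expectation (p : Fin 3 → Fin 4) (h0 : p 0 = 1 ∨ p 0 = 2)
    (h : ∏ a, pauliMatrix (p a) false true + ∏ a, pauliMatrix (p a) true false ≠ 0) :
    star ghzState ⬝ᵥ (pauliString p *ᵥ ghzState) ≠ 0 := by
  have hd (b : Bool) : ∏ a, pauliMatrix (p a) b b = 0 := by
    refine Finset.prod_eq_zero (Finset.mem_univ 0) ?_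
    rcases h0 with h0 | h0 <;> simp [h0, pauliMatrix_one_apply, pauliMatrix_two_apply]
  have hstar : star ghzState = ghzState := by
    funext y
    simp only [Pi.star_apply, ghzState]
    split_ifs <;> simp
  have e : ghzState ⬝ᵥ (pauliString p *ᵥ ghzState) =
      ((1 / √2 : ℝ) : ℂ) * (((1 / √2 : ℝ) : ℂ) *
        (∏ a, pauliMatrix (p a) false true + ∏ a, pauliMatrix (p a) true false)) := by
    rw [ghzState_eq, Matrix.mulVec_smul, smul_dotProduct, dotProduct_smul, Matrix.mulVec_add,
      Matrix.mulVec_single_one, Matrix.mulVec_single_one]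
    simp only [add_dotProduct, dotProduct_add, single_dotProduct, Matrix.col_apply, pauliString, hd,
      smul_eq_mul]
    ring
  rw [hstar, e]
  exact mul_ne_zero one_div_sqrt_two_ne_zero (mul_ne_zero one_div_sqrt_two_ne_zero h)

/-- A stabilizer that becomes diagonal in the measurement bases `W` determines a parity of the
measurement outcomes. -/
theorem prod_eq_of_mulVec_eq_smul {ι : Type} [Fintype ι] [DecidableEq ι]
    {ψ : (ι → Bool) → ℂ} {M W : ι → Matrix Bool Bool ℂ} {δ : ι → Bool → ℂ} {s : ℂ}
    (h : tensorMatrix M *ᵥ ψ = s • ψ) (hW : ∀ v, W v * M v = Matrix.diagonal (δ v) * W v)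
    {z : ι → Bool} (hz : (tensorMatrix W *ᵥ ψ) z ≠ 0) : ∏ v, δ v (z v) = s := by
  have e : tensorMatrix (fun v => Matrix.diagonal (δ v)) *ᵥ (tensorMatrix W *ᵥ ψ) =
      s • (tensorMatrix W *ᵥ ψ) := by
    rw [Matrix.mulVec_mulVec, tensorMatrix_mul, ← funext hW, ← tensorMatrix_mul,
      ← Matrix.mulVec_mulVec, h, Matrix.mulVec_smul]
  have := congrFun e z
  rw [tensorMatrix_diagonal_mulVec, Pi.smul_apply, smul_eq_mul] at this
  exact mul_right_cancel₀ hz this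

/-! ### The GHZ game with local outputs -/

/-- The change of basis from the eigenbasis of `X`, `Y` or `Z` (for `0`, `1`, `2`) to the
computational basis, multiplied by `√2`, so that for `X` and `Y` the entries are roots of unity. -/
noncomputable def basisChangeAux : Fin 3 → Matrix Bool Bool ℂ
  | 0 => fun a b => if b = true then (if a = true then -1 else 1) else 1
  | 1 => fun a b => if b = true then (if a = true then Complex.I else -Complex.I) else 1
  | 2 => fun a b => if a = b then ((√2 : ℝ) : ℂ) else 0

theorem basisChangeAux_two : basisChangeAux 2 = ((√2 : ℝ) : ℂ) • 1 := by
  ext a b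
  rw [Matrix.smul_apply, Matrix.one_apply, smul_eq_mul, mul_ite, mul_one, mul_zero]
  rfl

theorem basisChangeAux_zero_apply (a b : Bool) : basisChangeAux 0 a b =
    if b = true then (if a = true then -1 else 1) else 1 := rfl

theorem basisChangeAux_one_apply (a b : Bool) : basisChangeAux 1 a b =
    if b = true then (if a = true then Complex.I else -Complex.I) else 1 := rfl

/-- The change of basis from the eigenbasis of `X`, `Y` or `Z` (for `0`, `1`, `2`) to the
computational basis. -/
noncomputable def basisChange (i : Fin 3) : Matrix Bool Bool ℂ :=
  ((1 / √2 : ℝ) : ℂ) • basisChangeAux i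

theorem basisChange_two : basisChange 2 = 1 := by
  rw [basisChange, basisChangeAux_two, smul_smul, ← Complex.ofReal_mul,
    one_div_mul_cancel (by positivity), Complex.ofReal_one, one_smul]

theorem basisChange_conj (i : Fin 3) (P : Matrix Bool Bool ℂ) :
    basisChange i * P * (basisChange i)ᴴ =
      (1 / 2 : ℂ) • (basisChangeAux i * P * (basisChangeAux i)ᴴ) := by
  have h : ((1 / √2 : ℝ) : ℂ) * ((1 / √2 : ℝ) : ℂ) = 1 / 2 := by
    rw [← Complex.ofReal_mul, div_mul_div_comm, Real.mul_self_sqrt (by norm_num)]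
    simp
  have h' : star ((1 / √2 : ℝ) : ℂ) = ((1 / √2 : ℝ) : ℂ) := Complex.conj_ofReal _
  rw [basisChange, Matrix.conjTranspose_smul, h', Matrix.smul_mul, Matrix.smul_mul,
    Matrix.mul_smul, smul_smul, h]

theorem isQubitClifford_basisChange (i : Fin 3) : IsQubitClifford (basisChange i) := by
  fin_cases i
  · refine ⟨?_, fun j => ⟨![0, 3, 2, 1] j, ?_⟩⟩
    · rw [Matrix.mem_unitaryGroup_iff, Matrix.star_eq_conjTranspose]
      have h := basisChange_conj 0 1
      rw [Matrix.mul_one, Matrix.mul_one] at h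
      refine h.trans ?_
      ext a b
      cases a <;> cases b <;>
        simp [Matrix.mul_apply, basisChangeAux_zero_apply] <;> norm_num
    · simp only [basisChange_conj]
      fin_cases j
      · left; ext a b
        cases a <;> cases b <;>
          simp [Matrix.mul_apply, basisChangeAux_zero_apply, pauliMatrix_zero] <;> norm_num
      · left; ext a b
        cases a <;> cases b <;>
          simp [Matrix.mul_apply, basisChangeAux_zero_apply, pauliMatrix_one_apply,
            pauliMatrix_three_apply] <;> norm_num
      · right; ext a b
        cases a <;> cases b <;>
          simp [Matrix.mul_apply, basisChangeAux_zero_apply, pauliMatrix_two_apply] <;> ring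
      · left; ext a b
        cases a <;> cases b <;>
          simp [Matrix.mul_apply, basisChangeAux_zero_apply, pauliMatrix_one_apply,
            pauliMatrix_three_apply] <;> norm_num
  · refine ⟨?_, fun j => ⟨![0, 2, 3, 1] j, ?_⟩⟩
    · rw [Matrix.mem_unitaryGroup_iff, Matrix.star_eq_conjTranspose]
      have h := basisChange_conj 1 1
      rw [Matrix.mul_one, Matrix.mul_one] at h
      refine h.trans ?_
      ext a b
      cases a <;> cases b <;>
        simp [Matrix.mul_apply, basisChangeAux_one_apply] <;> norm_num
    · simp only [basisChange_conj]
      fin_cases j <;> left <;> ext a b <;> cases a <;> cases b <;>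
        simp [Matrix.mul_apply, basisChangeAux_one_apply, pauliMatrix_zero,
          pauliMatrix_one_apply, pauliMatrix_two_apply, pauliMatrix_three_apply] <;> ring_nf
  · rw [show ((⟨2, by decide⟩ : Fin 3)) = 2 from rfl, basisChange_two]
    exact IsQubitClifford.one

/-- The measurement bases in the ten parity relations below. -/
def gameBases : Fin 10 → Fin 3 → Fin 3 :=
  ![![0, 0, 0], ![0, 1, 1], ![1, 0, 1], ![1, 1, 0], ![0, 2, 2], ![1, 2, 2], ![2, 0, 2], ![2, 1, 2],
    ![2, 2, 0], ![2, 2, 1]]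

/-- The products of stabilizers `A`, `B`, `C` that are measured in the ten parity relations. -/
def gameProducts {M : Type*} [Mul M] (A B C : M) : Fin 10 → M :=
  ![A, B, C, A * B * C, A * B, A * B, A * C, A * C, B * C, B * C]

theorem prod_gameProducts {s₁ s₂ s₃ : ℂ} (h₁ : s₁ * s₁ = 1) (h₂ : s₂ * s₂ = 1)
    (h₃ : s₃ * s₃ = 1) : ∏ m, gameProducts s₁ s₂ s₃ m = 1 := by
  simp [gameProducts, Fin.prod_univ_succ]
  grind

theorem pauliX_mul_self : pauliMatrix 1 * pauliMatrix 1 = 1 := by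
  ext a b; cases a <;> cases b <;> simp [Matrix.mul_apply, pauliMatrix_one_apply]

theorem pauliY_mul_self : pauliMatrix 2 * pauliMatrix 2 = 1 := by
  ext a b; cases a <;> cases b <;> simp [Matrix.mul_apply, pauliMatrix_two_apply]

theorem pauliX_mul_pauliY :
    pauliMatrix 1 * pauliMatrix 2 = Matrix.diagonal fun b => Complex.I * boolSign b := by
  ext a b
  cases a <;> cases b <;>
    simp [Matrix.mul_apply, pauliMatrix_one_apply, pauliMatrix_two_apply, boolSign]

theorem pauliY_mul_pauliX :
    pauliMatrix 2 * pauliMatrix 1 = Matrix.diagonal fun b => -Complex.I * boolSign b := by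
  ext a b
  cases a <;> cases b <;>
    simp [Matrix.mul_apply, pauliMatrix_one_apply, pauliMatrix_two_apply, boolSign]

theorem diagonal_mul_pauliX :
    (Matrix.diagonal fun b => Complex.I * boolSign b) * pauliMatrix 1 = -pauliMatrix 2 := by
  ext a b
  rw [Matrix.diagonal_mul]
  cases a <;> cases b <;> simp [pauliMatrix_one_apply, pauliMatrix_two_apply, boolSign]

theorem diagonal_mul_pauliY :
    (Matrix.diagonal fun b => Complex.I * boolSign b) * pauliMatrix 2 = pauliMatrix 1 := by
  ext a b
  rw [Matrix.diagonal_mul]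
  cases a <;> cases b <;> simp [pauliMatrix_one_apply, pauliMatrix_two_apply, boolSign]

theorem basisChange_zero_mul :
    basisChange 0 * pauliMatrix 1 = Matrix.diagonal boolSign * basisChange 0 := by
  rw [basisChange, Matrix.smul_mul, Matrix.mul_smul]
  congr 1
  ext a b
  rw [Matrix.diagonal_mul]
  cases a <;> cases b <;>
    simp [Matrix.mul_apply, pauliMatrix_one_apply, basisChangeAux_zero_apply, boolSign]

theorem basisChange_one_mul :
    basisChange 1 * pauliMatrix 2 = Matrix.diagonal boolSign * basisChange 1 := by
  rw [basisChange, Matrix.smul_mul, Matrix.mul_smul]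
  congr 1
  ext a b
  rw [Matrix.diagonal_mul]
  cases a <;> cases b <;>
    simp [Matrix.mul_apply, pauliMatrix_two_apply, basisChangeAux_one_apply, boolSign]

theorem boolSign_mul_self (b : Bool) : boolSign b * boolSign b = 1 := by
  cases b <;> simp [boolSign]

/-- The stabilizers `XXX`, `XYY`, `YXY` of the GHZ state, up to sign. -/
def ghzPauli : Fin 3 → Fin 3 → Fin 4 := ![![1, 1, 1], ![1, 2, 2], ![2, 1, 2]]

/-- On a qubit of the triple, each of the ten products becomes diagonal in the measurement basis,
and the product of its eigenvalues is `1`, except on the qubit `1`, where it is `-1` since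
`X Y X = -Y`. -/
theorem exists_eigenvalues_of_triple (a : Fin 3) :
    ∃ δ : Fin 10 → Bool → ℂ,
      (∀ m, basisChange (gameBases m a) * gameProducts (pauliMatrix (ghzPauli 0 a))
        (pauliMatrix (ghzPauli 1 a)) (pauliMatrix (ghzPauli 2 a)) m =
          Matrix.diagonal (δ m) * basisChange (gameBases m a)) ∧
      ∀ g : Fin 3 → Bool, ∏ m, δ m (g (gameBases m a)) = if a = 1 then -1 else 1 := by
  have hI := Complex.I_mul_I
  fin_cases a
  · refine ⟨![boolSign, boolSign, boolSign, boolSign, fun _ => 1, fun _ => 1,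
      fun b => Complex.I * boolSign b, fun b => Complex.I * boolSign b,
      fun b => Complex.I * boolSign b, fun b => Complex.I * boolSign b], fun m => ?_, fun g => ?_⟩
    · fin_cases m <;>
        simp [gameBases, gameProducts, ghzPauli, basisChange_two, pauliX_mul_pauliY,
          pauliX_mul_self, basisChange_zero_mul, basisChange_one_mul]
    · have h0 := boolSign_mul_self (g 0)
      have h1 := boolSign_mul_self (g 1)
      have h2 := boolSign_mul_self (g 2)
      simp [gameBases, Fin.prod_univ_succ]
      grind
  · refine ⟨![boolSign, boolSign, boolSign, fun b => -boolSign b,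
      fun b => Complex.I * boolSign b, fun b => Complex.I * boolSign b, fun _ => 1, fun _ => 1,
      fun b => -Complex.I * boolSign b, fun b => -Complex.I * boolSign b], fun m => ?_, fun g => ?_⟩
    · have hneg : Matrix.diagonal (fun b => -boolSign b) = -Matrix.diagonal boolSign :=
        (Matrix.diagonal_neg _).symm
      fin_cases m <;>
        simp [gameBases, gameProducts, ghzPauli, basisChange_two, pauliX_mul_pauliY,
          pauliX_mul_self, pauliY_mul_pauliX, diagonal_mul_pauliX, basisChange_zero_mul,
          basisChange_one_mul]
      rw [hneg, Matrix.neg_mul]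
    · have h0 := boolSign_mul_self (g 0)
      have h1 := boolSign_mul_self (g 1)
      have h2 := boolSign_mul_self (g 2)
      simp [gameBases, Fin.prod_univ_succ]
      grind
  · refine ⟨![boolSign, boolSign, boolSign, boolSign,
      fun b => Complex.I * boolSign b, fun b => Complex.I * boolSign b,
      fun b => Complex.I * boolSign b, fun b => Complex.I * boolSign b, fun _ => 1, fun _ => 1],
      fun m => ?_, fun g => ?_⟩
    · fin_cases m <;>
        simp [gameBases, gameProducts, ghzPauli, basisChange_two, pauliX_mul_pauliY,
          pauliY_mul_self, diagonal_mul_pauliY, basisChange_zero_mul, basisChange_one_mul]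
    · have h0 := boolSign_mul_self (g 0)
      have h1 := boolSign_mul_self (g 1)
      have h2 := boolSign_mul_self (g 2)
      simp [gameBases, Fin.prod_univ_succ]
      grind

/-- On a measured qubit, where the stabilizers are diagonal, the ten eigenvalues have product `1` if
the outcome on the qubit depends on the measurement basis of a single qubit `a` of the triple. -/
theorem exists_eigenvalues_of_measured (a : Fin 3) (q : Fin 3 → Fin 4)
    (hq : ∀ i, q i = 0 ∨ q i = 3) :
    ∃ δ : Fin 10 → Bool → ℂ,
      (∀ m, gameProducts (pauliMatrix (q 0)) (pauliMatrix (q 1)) (pauliMatrix (q 2)) m =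
          Matrix.diagonal (δ m)) ∧
      ∀ g : Fin 3 → Bool, ∏ m, δ m (g (gameBases m a)) = 1 := by
  have h (i : Fin 3) : ∃ d : Bool → ℂ, pauliMatrix (q i) = Matrix.diagonal d ∧
      ∀ b, d b * d b = 1 := by
    rcases hq i with h | h
    · exact ⟨fun _ => 1, by rw [h, pauliMatrix_zero, Matrix.diagonal_one], by simp⟩
    · exact ⟨boolSign, by rw [h, pauliMatrix_three], boolSign_mul_self⟩
  choose d hd hd1 using h
  refine ⟨gameProducts (d 0) (d 1) (d 2), fun m => ?_, fun g => ?_⟩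
  · fin_cases m <;> simp [gameProducts, hd, Matrix.diagonal_mul_diagonal, Pi.mul_def]
  · have h00 := hd1 0 (g 0)
    have h01 := hd1 0 (g 1)
    have h02 := hd1 0 (g 2)
    have h10 := hd1 1 (g 0)
    have h11 := hd1 1 (g 1)
    have h12 := hd1 1 (g 2)
    have h20 := hd1 2 (g 0)
    have h21 := hd1 2 (g 1)
    have h22 := hd1 2 (g 2)
    fin_cases a <;> simp [gameBases, gameProducts, Fin.prod_univ_succ] <;> grind

theorem tensorMatrix_mulVec_gameProducts {ι : Type} [Fintype ι] [DecidableEq ι]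
    {ψ : (ι → Bool) → ℂ} {A : Fin 3 → ι → Matrix Bool Bool ℂ} {s : Fin 3 → ℂ}
    (h : ∀ i, tensorMatrix (A i) *ᵥ ψ = s i • ψ) (m : Fin 10) :
    tensorMatrix (fun v => gameProducts (A 0 v) (A 1 v) (A 2 v) m) *ᵥ ψ =
      gameProducts (s 0) (s 1) (s 2) m • ψ := by
  have h2 (i j : Fin 3) : tensorMatrix (fun v => A i v * A j v) *ᵥ ψ = (s i * s j) • ψ := by
    rw [← tensorMatrix_mul, ← Matrix.mulVec_mulVec, h, Matrix.mulVec_smul, h, smul_smul, mul_comm]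
  have h3 : tensorMatrix (fun v => A 0 v * A 1 v * A 2 v) *ᵥ ψ = (s 0 * s 1 * s 2) • ψ := by
    rw [← tensorMatrix_mul (fun v => A 0 v * A 1 v), ← Matrix.mulVec_mulVec, h, Matrix.mulVec_smul,
      h2, smul_smul, mul_comm]
  fin_cases m
  exacts [h 0, h 1, h 2, h3, h2 0 1, h2 0 1, h2 0 2, h2 0 2, h2 1 2, h2 1 2]

/-- No output bits `F β` are possible measurement outcomes in all bases `β` of the triple, if each
output bit depends on the basis of one qubit of the triple, which for the outcome on a qubit of the
triple is that qubit. The four parities of the GHZ game alone do not exclude this, since the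
correction by the measured bits may depend on the bases. Two `Z` measurements, however, have a
definite parity, whose correction cannot depend on the third basis; the six parities with two `Z`
measurements cancel the corrections. -/
theorem not_forall_output_possible {n : ℕ} (t : Fin 3 ↪ Fin n) {ψ : (Fin n → Bool) → ℂ}
    {q : Fin 3 → Fin n → Fin 4} {s : Fin 3 → ℂ} (hs : ∀ i, s i * s i = 1)
    (hψ : ∀ i, pauliString (q i) *ᵥ ψ = s i • ψ) (hqt : ∀ i a, q i (t a) = ghzPauli i a)
    (hq : ∀ i v, v ∉ Set.range t → q i v = 0 ∨ q i v = 3)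
    {F : (Fin 3 → Fin 3) → Fin n → Bool} {cls : Fin n → Fin 3} (hcls : ∀ a, cls (t a) = a)
    (hF : ∀ β β' v, β (cls v) = β' (cls v) → F β v = F β' v)
    (hsupp : ∀ β, (tensorMatrix (onTriple t fun a => basisChange (β a)) *ᵥ ψ) (F β) ≠ 0) :
    False := by
  have key (v : Fin n) : ∃ δ : Fin 10 → Bool → ℂ,
      (∀ m, onTriple t (fun a => basisChange (gameBases m a)) v *
        gameProducts (pauliMatrix (q 0 v)) (pauliMatrix (q 1 v)) (pauliMatrix (q 2 v)) m =
          Matrix.diagonal (δ m) * onTriple t (fun a => basisChange (gameBases m a)) v) ∧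
      ∏ m, δ m (F (gameBases m) v) = if v = t 1 then -1 else 1 := by
    have hFv (m : Fin 10) : F (gameBases m) v =
        (fun b => F (fun _ => b) v) (gameBases m (cls v)) := hF _ _ _ rfl
    by_cases hv : v ∈ Set.range t
    · obtain ⟨a, rfl⟩ := hv
      obtain ⟨δ, h1, h2⟩ := exists_eigenvalues_of_triple a
      refine ⟨δ, fun m => ?_, ?_⟩
      · simpa only [onTriple_apply, hqt] using h1 m
      · simp only [hFv, hcls, t.injective.eq_iff]
        exact h2 fun b => F (fun _ => b) (t a)
    · obtain ⟨δ, h1, h2⟩ := exists_eigenvalues_of_measured (cls v) (fun i => q i v)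
        fun i => hq i v hv
      refine ⟨δ, fun m => ?_, ?_⟩
      · rw [onTriple_apply_of_notMem t _ hv, h1 m, one_mul, mul_one]
      · rw [if_neg fun h => hv ⟨1, h.symm⟩]
        simp only [hFv]
        exact h2 fun b => F (fun _ => b) v
  choose δ hδ hprod using key
  have hparity (m : Fin 10) : ∏ v, δ v m (F (gameBases m) v) =
      gameProducts (s 0) (s 1) (s 2) m :=
    prod_eq_of_mulVec_eq_smul (tensorMatrix_mulVec_gameProducts hψ m) (fun v => hδ v m)
      (hsupp (gameBases m))
  have h1 : ∏ v, ∏ m, δ v m (F (gameBases m) v) = 1 := by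
    rw [Finset.prod_comm, Finset.prod_congr rfl fun m _ => hparity m]
    exact prod_gameProducts (hs 0) (hs 1) (hs 2)
  simp only [hprod, Finset.prod_ite_eq', Finset.mem_univ, if_true] at h1
  norm_num at h1

/-- If a triple exhibits GHZ-type MIE in the output state of a circuit, and each output bit of a
classical algorithm depends on at most one of three rotations of the qubits of the triple, then the
algorithm fails for some rotations. -/
theorem exists_rotation_output_impossible {n : ℕ} (T : CircuitTemplate n) (U : T.Gates)
    (t : Fin 3 ↪ Fin n) (h : HasGHZTypeMIE (outputState T U) t) {w : Fin 3 → Fin T.R}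
    (hw : ∀ a, IsLastGate T (t a) (w a)) {F : (Fin 3 → CliffordGate Unit) → Fin n → Bool}
    {cls : Fin n → Fin 3} (hcls : ∀ a, cls (t a) = a)
    (hF : ∀ V V' v, V (cls v) = V' (cls v) → F V v = F V' v) :
    ∃ V, outputState T (rotateTriple T w t V U) (F V) = 0 := by
  by_contra! hne
  obtain ⟨x, M, μ, hM, hμ, hg⟩ := exists_frame_of_hasGHZTypeMIE t (outputState_ne_zero T U) h
  have hMt (v : Fin n) : IsQubitClifford (onTriple t M v) := by
    by_cases hv : v ∈ Set.range t
    · obtain ⟨a, rfl⟩ := hv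
      rw [onTriple_apply]
      exact hM a
    · rw [onTriple_apply_of_notMem t M hv]
      exact IsQubitClifford.one
  have hC : IsClifford (tensorMatrix (onTriple t M) * circuitUnitary T U) :=
    (isClifford_tensorMatrix hMt).mul (isClifford_circuitUnitary T U)
  have hψ : tensorMatrix (onTriple t M) *ᵥ outputState T U =
      (tensorMatrix (onTriple t M) * circuitUnitary T U) *ᵥ Pi.single (fun _ => false) 1 := by
    rw [outputState, Matrix.mulVec_mulVec]
  have hp (i : Fin 3) :
      star ghzState ⬝ᵥ (pauliString (ghzPauli i) *ᵥ ghzState) ≠ 0 := by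
    refine ghzState_expectation _ ?_ ?_
    · fin_cases i <;> simp [ghzPauli]
    · fin_cases i <;>
        simp [ghzPauli, Fin.prod_univ_succ, pauliMatrix_one_apply, pauliMatrix_two_apply]
  rw [hψ] at hg
  choose q s hs hqt hq hst using fun i =>
    exists_stabilizer_of_projectedState_eq t hC hμ hg (ghzPauli i) (hp i)
  have hW (β : Fin 3 → Fin 3) (a : Fin 3) : IsQubitClifford (basisChange (β a) * M a) :=
    (isQubitClifford_basisChange _).mul (hM a)
  refine not_forall_output_possible t hs hst hqt hq
    (F := fun β => F fun a => qubitGate (basisChange (β a) * M a) (hW β a)) hcls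
    (fun β β' v hβ => hF _ _ _ ?_) fun β => ?_
  · simp only [hβ]
  · obtain ⟨z, hz, hrot⟩ := outputState_rotateTriple T hw (hW β) U
    have h1 := hne fun a => qubitGate (basisChange (β a) * M a) (hW β a)
    rw [hrot, Pi.smul_apply, ← onTriple_mul, ← Matrix.mulVec_mulVec, hψ] at h1
    exact right_ne_zero_of_smul h1

/-! ### Light cones of Boolean circuits -/

namespace BoolCircuit

variable {ι : Type} {n : ℕ}

theorem exists_gateValue_support (C : BoolCircuit ι n) {K : ℕ} (hK : 1 ≤ K)
    (hf : ∀ g, C.fanIn g ≤ K) (g : Fin C.size) :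
    ∃ S : Finset ι, S.card ≤ K ^ C.gateDepth g ∧
      ∀ x y : ι → Bool, (∀ i ∈ S, x i = y i) → C.gateValue x g = C.gateValue y g := by
  classical
  induction g using WellFoundedLT.induction with
  | _ g ih =>
    let B : Fin (C.fanIn g) → ℕ := fun a =>
      match C.src g a with
      | Sum.inl _ => 0
      | Sum.inr g' => C.gateDepth ⟨g'.1, g'.2.trans g.2⟩
    have hdepth : C.gateDepth g = 1 + Finset.univ.sup B :=
      gateDepth.eq_1 C g
    have h (a : Fin (C.fanIn g)) : ∃ S : Finset ι, S.card ≤ K ^ Finset.univ.sup B ∧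
        ∀ x y : ι → Bool, (∀ i ∈ S, x i = y i) →
          (match C.src g a with
            | Sum.inl i => x i
            | Sum.inr g' => C.gateValue x ⟨g'.1, g'.2.trans g.2⟩) =
          (match C.src g a with
            | Sum.inl i => y i
            | Sum.inr g' => C.gateValue y ⟨g'.1, g'.2.trans g.2⟩) := by
      have hB : B a ≤ Finset.univ.sup B := Finset.le_sup (f := B) (Finset.mem_univ a)
      rcases hsrc : C.src g a with i | g'
      · refine ⟨{i}, ?_, fun x y hxy => hxy i (by simp)⟩
        rw [Finset.card_singleton]
        exact Nat.one_le_pow _ _ hK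
      · obtain ⟨S, hS, hS'⟩ := ih ⟨g'.1, g'.2.trans g.2⟩ g'.2
        refine ⟨S, hS.trans (Nat.pow_le_pow_right hK ?_), hS'⟩
        simpa only [B, hsrc] using hB
    choose S hS hS' using h
    refine ⟨Finset.univ.biUnion S, ?_, fun x y hxy => ?_⟩
    · refine (Finset.card_biUnion_le_card_mul _ _ _ fun a _ => hS a).trans ?_
      rw [hdepth, pow_add, pow_one, Finset.card_univ, Fintype.card_fin]
      exact Nat.mul_le_mul_right _ (hf g)
    · rw [gateValue, gateValue]
      congr 1
      funext a
      exact hS' a x y fun i hi => hxy i (Finset.mem_biUnion.2 ⟨a, Finset.mem_univ a, hi⟩)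

/-- An output bit of a circuit of fan-in `K` and depth `D` depends on at most `K ^ D` input bits. -/
theorem exists_eval_support (C : BoolCircuit ι n) {K D : ℕ} (hK : 1 ≤ K)
    (hf : ∀ g, C.fanIn g ≤ K) (hD : C.depth ≤ D) (v : Fin n) :
    ∃ S : Finset ι, S.card ≤ K ^ D ∧
      ∀ x y : ι → Bool, (∀ i ∈ S, x i = y i) → C.eval x v = C.eval y v := by
  let B : Fin n → ℕ := fun v =>
    match C.out v with
    | Sum.inl _ => 0
    | Sum.inr g => C.gateDepth g
  have hB : B v ≤ D := (Finset.le_sup (f := B) (Finset.mem_univ v)).trans hD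
  simp only [eval]
  rcases hout : C.out v with i | g
  · refine ⟨{i}, ?_, fun x y hxy => hxy i (by simp)⟩
    rw [Finset.card_singleton]
    exact Nat.one_le_pow _ _ hK
  · obtain ⟨S, hS, hS'⟩ := C.exists_gateValue_support hK hf g
    refine ⟨S, hS.trans (Nat.pow_le_pow_right hK ?_), hS'⟩
    simpa only [B, hout] using hB

end BoolCircuit

/-- Each output bit of a probabilistic classical circuit of fan-in `K` and depth `D` depends on at
most `K ^ D` of the Clifford gates. -/
theorem ProbClassicalCircuit.exists_output_support {n : ℕ} {T : CircuitTemplate n}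
    (F : ProbClassicalCircuit T) {K D : ℕ} (hK : 1 ≤ K) (hf : ∀ g, F.circuit.fanIn g ≤ K)
    (hD : F.circuit.depth ≤ D) (v : Fin n) :
    ∃ L : Finset (Fin T.R), L.card ≤ K ^ D ∧
      ∀ (U U' : T.Gates) (r : Fin F.numRandom → Bool), (∀ w ∈ L, U w = U' w) →
        F.output U r v = F.output U' r v := by
  classical
  obtain ⟨S, hS, hS'⟩ := F.circuit.exists_eval_support hK hf hD v
  refine ⟨S.toLeft.image Sigma.fst, (Finset.card_image_le.trans Finset.card_toLeft_le).trans hS,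
    fun U U' r h => hS' _ _ fun i hi => ?_⟩
  rcases i with s | i
  · simp only [Sum.elim_inl]
    rw [h s.1 (Finset.mem_image.2 ⟨s, Finset.mem_toLeft.2 hi, rfl⟩)]
  · rfl

/-! ### Separated triples -/

section Separated

variable {n : ℕ} (T : CircuitTemplate n)

/-- A triple is separated, for sets `L v` of gates that influence the output bits `v`, if no output
bit is influenced by gates on different qubits of the triple; the last gate on the qubit `v` is
counted among the gates that influence `v`. -/
def IsSeparated (L : Fin n → Finset (Fin T.R)) (t : Fin 3 ↪ Fin n) : Prop :=
  ∀ a b, a ≠ b → ∀ v, ∀ w w', (w ∈ L v ∨ IsLastGate T v w) → (w' ∈ L v ∨ IsLastGate T v w') →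
    t a ∈ T.supp w → t b ∉ T.supp w'

theorem IsLastGate.unique {q : Fin n} {w w' : Fin T.R} (h : IsLastGate T q w)
    (h' : IsLastGate T q w') : w = w' := by
  by_contra hne
  rcases lt_or_gt_of_ne hne with hlt | hlt
  · exact h.2 _ hlt h'.1
  · exact h'.2 _ hlt h.1

open Classical in
theorem card_not_isSeparated_le {k M : ℕ} (hT : T.IsLocal k) {L : Fin n → Finset (Fin T.R)}
    (hL : ∀ v, (L v).card ≤ M) :
    (Finset.univ.filter fun t : Fin 3 ↪ Fin n => ¬ IsSeparated T L t).card ≤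
      6 * (n * ((M + 1) * k) ^ 2 * n) := by
  let L' : Fin n → Finset (Fin T.R) := fun v => L v ∪ Finset.univ.filter fun w => IsLastGate T v w
  have hL' (v : Fin n) : (L' v).card ≤ M + 1 := by
    refine (Finset.card_union_le _ _).trans (Nat.add_le_add (hL v) (Finset.card_le_one.2 ?_))
    intro w hw w' hw'
    exact IsLastGate.unique T (by simpa using hw) (by simpa using hw')
  let A : Fin n → Finset (Fin n) := fun v => (L' v).biUnion T.supp
  have hA (v : Fin n) : (A v).card ≤ (M + 1) * k :=
    (Finset.card_biUnion_le_card_mul _ _ k fun w _ => (hT w).le).trans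
      (Nat.mul_le_mul_right k (hL' v))
  let B : Finset (Fin n × Fin n) := Finset.univ.biUnion fun v => A v ×ˢ A v
  have hB : B.card ≤ n * ((M + 1) * k) ^ 2 := by
    refine (Finset.card_biUnion_le_card_mul _ _ (((M + 1) * k) ^ 2) fun v _ => ?_).trans ?_
    · rw [Finset.card_product, pow_two]
      exact Nat.mul_le_mul (hA v) (hA v)
    · rw [Finset.card_univ, Fintype.card_fin]
  have hpair (a b : Fin 3) (hab : a ≠ b) :
      (Finset.univ.filter fun t : Fin 3 ↪ Fin n => (t a, t b) ∈ B).card ≤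
        n * ((M + 1) * k) ^ 2 * n := by
    obtain ⟨c, hc⟩ : ∃ c : Fin 3, ∀ i, i = a ∨ i = b ∨ i = c := by
      revert a b; decide
    have hle : (Finset.univ.filter fun t : Fin 3 ↪ Fin n => (t a, t b) ∈ B).card ≤
        (B ×ˢ (Finset.univ : Finset (Fin n))).card := by
      refine Finset.card_le_card_of_injOn (fun t => ((t a, t b), t c)) (fun t ht => ?_) ?_
      · simpa using ht
      · intro t _ t' _ h
        simp only [Prod.mk.injEq] at h
        ext i
        rcases hc i with rfl | rfl | rfl
        · rw [h.1.1]
        · rw [h.1.2]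
        · rw [h.2]
    refine hle.trans ?_
    rw [Finset.card_product, Finset.card_univ, Fintype.card_fin]
    exact Nat.mul_le_mul_right n hB
  have hsub : (Finset.univ.filter fun t : Fin 3 ↪ Fin n => ¬ IsSeparated T L t) ⊆
      (Finset.univ.filter fun p : Fin 3 × Fin 3 => p.1 ≠ p.2).biUnion fun p =>
        Finset.univ.filter fun t : Fin 3 ↪ Fin n => (t p.1, t p.2) ∈ B := by
    intro t ht
    have ht := (Finset.mem_filter.1 ht).2
    rw [IsSeparated] at ht
    push Not at ht
    obtain ⟨a, b, hab, v, w, w', hw, hw', ha, hb⟩ := ht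
    refine Finset.mem_biUnion.2 ⟨(a, b), by simpa using hab, ?_⟩
    simp only [Finset.mem_filter, Finset.mem_univ, true_and]
    refine Finset.mem_biUnion.2 ⟨v, Finset.mem_univ v, Finset.mk_mem_product ?_ ?_⟩
    · exact Finset.mem_biUnion.2 ⟨w, by simpa [L'] using hw, ha⟩
    · exact Finset.mem_biUnion.2 ⟨w', by simpa [L'] using hw', hb⟩
  refine (Finset.card_le_card hsub).trans ((Finset.card_biUnion_le_card_mul _ _ _
    fun p hp => hpair p.1 p.2 (by simpa using hp)).trans (Nat.mul_le_mul_right _ ?_))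
  decide

/-- For a separated triple, a deterministic algorithm with local outputs that succeeded on all
rotations of a circuit with GHZ-type MIE would contradict `exists_rotation_output_impossible`.
Since every rotation permutes the circuits, the algorithm fails for a constant fraction of the
circuits with GHZ-type MIE. -/
theorem card_hasGHZTypeMIE_le {L : Fin n → Finset (Fin T.R)} {t : Fin 3 ↪ Fin n}
    (ht : IsSeparated T L t) {G : T.Gates → Fin n → Bool}
    (hG : ∀ v (U U' : T.Gates), (∀ w ∈ L v, U w = U' w) → G U v = G U' v) :
    Nat.card {U : T.Gates // HasGHZTypeMIE (outputState T U) t} ≤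
      Nat.card (Fin 3 → CliffordGate Unit) *
        Nat.card {U : T.Gates // outputState T U (G U) = 0} := by
  classical
  by_cases hlast : ∀ a, ∃ w, IsLastGate T (t a) w
  · choose w hw using hlast
    let Fail : Finset T.Gates := Finset.univ.filter fun U => outputState T U (G U) = 0
    have hsub : (Finset.univ.filter fun U : T.Gates => HasGHZTypeMIE (outputState T U) t) ⊆
        Finset.univ.biUnion fun V : Fin 3 → CliffordGate Unit =>
          Finset.univ.filter fun U => rotateTriple T w t V U ∈ Fail := by
      intro U hU
      have hU : HasGHZTypeMIE (outputState T U) t := by simpa using hU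
      -- the qubit of the triple whose last gate influences the output bit `v`, if there is one
      let cls : Fin n → Fin 3 := fun v =>
        if h : ∃ a, w a ∈ L v ∨ IsLastGate T v (w a) then h.choose else 0
      have hcls (v : Fin n) (a : Fin 3) (ha : w a ∈ L v ∨ IsLastGate T v (w a)) : cls v = a := by
        have h : ∃ a, w a ∈ L v ∨ IsLastGate T v (w a) := ⟨a, ha⟩
        have e : cls v = h.choose := dif_pos h
        by_contra hne
        rw [e] at hne
        exact ht _ _ hne v _ _ h.choose_spec ha (hw _).1 (hw a).1
      obtain ⟨V, hV⟩ := exists_rotation_output_impossible T U t hU hw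
        (F := fun V => G (rotateTriple T w t V U)) (cls := cls)
        (fun a => hcls _ _ (Or.inr (hw a)))
        (fun V V' v hVV => hG v _ _ fun j hj =>
          rotateTriple_apply_congr T t U hVV fun b hb hjb =>
            hb (hcls v b (Or.inl (hjb ▸ hj))).symm)
      exact Finset.mem_biUnion.2 ⟨V, Finset.mem_univ V, by simpa [Fail] using hV⟩
    have hcard := (Finset.card_le_card hsub).trans (Finset.card_biUnion_le_card_mul _ _ Fail.card
      fun V _ => Finset.card_le_card_of_injOn (rotateTriple T w t V) (fun U hU => by simpa using hU)
        (rotateTriple_injective T w t V).injOn)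
    simpa [Nat.card_eq_fintype_card, Fintype.card_subtype, Fail] using hcard
  · push Not at hlast
    obtain ⟨a, ha⟩ := hlast
    have hempty : IsEmpty {U : T.Gates // HasGHZTypeMIE (outputState T U) t} := by
      refine ⟨fun ⟨U, hU⟩ => ?_⟩
      obtain ⟨x, M, μ, hM, hμ, hg⟩ := exists_frame_of_hasGHZTypeMIE t (outputState_ne_zero T U) hU
      refine onQubit_pauliZ_mulVec_ne t hM hμ hg a (onQubit_pauliZ_mulVec_outputState T
        (fun w hw => ?_) U)
      obtain ⟨w', hw'⟩ := exists_isLastGate T ⟨w, hw⟩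
      exact ha w' hw'
    rw [Nat.card_of_isEmpty]
    exact Nat.zero_le _

end Separated

/-! ### The error of a classical circuit -/

theorem ProbClassicalCircuit.prob_eq {n : ℕ} {T : CircuitTemplate n}
    (F : ProbClassicalCircuit T) (U : T.Gates) (z : Fin n → Bool) :
    F.prob U z = ∑ r, if z = F.output U r then (F.randomDist r).toReal else 0 := by
  classical
  rw [prob, PMF.map_apply, tsum_fintype, ENNReal.toReal_sum]
  · refine Finset.sum_congr rfl fun r _ => ?_
    split_ifs <;> simp
  · intro r _
    split_ifs
    · exact F.randomDist.apply_ne_top r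
    · exact ENNReal.zero_ne_top

/-- The expected error is at least the probability of an output that is impossible in the quantum
circuit. -/
theorem ProbClassicalCircuit.le_expectedError {n : ℕ} {T : CircuitTemplate n}
    (F : ProbClassicalCircuit T) {e : ℝ}
    (h : ∀ r, e * Nat.card T.Gates ≤
      Nat.card {U : T.Gates // outputState T U (F.output U r) = 0}) :
    e ≤ F.expectedError := by
  classical
  have hpos : (0 : ℝ) < Fintype.card T.Gates := by
    have : Nonempty T.Gates := ⟨fun w => Quotient.mk _ ⟨1, IsClifford.one⟩⟩
    exact_mod_cast Fintype.card_pos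
  have hsum : ∑ r, (F.randomDist r).toReal = 1 := by
    rw [← ENNReal.toReal_sum fun r _ => F.randomDist.apply_ne_top r,
      ← tsum_fintype (L := .unconditional _),
      F.randomDist.tsum_coe, ENNReal.toReal_one]
  rw [expectedError, le_div_iff₀ hpos]
  calc e * Fintype.card T.Gates
      = ∑ r, (F.randomDist r).toReal * (e * Nat.card T.Gates) := by
        rw [← Finset.sum_mul, hsum, one_mul, Nat.card_eq_fintype_card]
    _ ≤ ∑ r, (F.randomDist r).toReal *
          Nat.card {U : T.Gates // outputState T U (F.output U r) = 0} :=
        Finset.sum_le_sum fun r _ => mul_le_mul_of_nonneg_left (h r) ENNReal.toReal_nonneg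
    _ = ∑ U : T.Gates, ∑ r, if outputState T U (F.output U r) = 0 then
          (F.randomDist r).toReal else 0 := by
        rw [Finset.sum_comm]
        refine Finset.sum_congr rfl fun r _ => ?_
        rw [Nat.card_eq_fintype_card, Fintype.card_subtype, ← Finset.sum_filter, Finset.sum_const,
          nsmul_eq_mul, mul_comm]
    _ ≤ ∑ U : T.Gates, ∑ z : Fin n → Bool, |F.prob U z - quantumProb T U z| := by
        refine Finset.sum_le_sum fun U _ => ?_
        calc ∑ r, (if outputState T U (F.output U r) = 0 then (F.randomDist r).toReal else 0)
            = ∑ z, if outputState T U z = 0 then F.prob U z else 0 := by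
              simp only [F.prob_eq, ← Finset.sum_filter, Finset.sum_comm' (s := Finset.univ.filter
                fun z => outputState T U z = 0) (t := fun z => Finset.univ.filter fun r =>
                  z = F.output U r) (t' := Finset.univ.filter fun r =>
                    outputState T U (F.output U r) = 0) (s' := fun r => {F.output U r})
                (h := by intro z r; simp; grind)]
              simp
          _ ≤ _ := by
              refine Finset.sum_le_sum fun z _ => ?_
              split_ifs with hz
              · rw [quantumProb, hz]
                simpa using le_abs_self _
              · exact abs_nonneg _

/-! ### Counting -/

theorem natCast_card_triple (n : ℕ) (hn : 3 ≤ n) :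
    2 / 9 * (n : ℝ) ^ 3 ≤ Nat.card (Fin 3 ↪ Fin n) := by
  obtain ⟨m, rfl⟩ := Nat.exists_eq_add_of_le' hn
  rw [Nat.card_eq_fintype_card, Fintype.card_embedding_eq, Fintype.card_fin, Fintype.card_fin]
  simp only [Nat.descFactorial]
  have h1 : m + 3 - 2 = m + 1 := by lia
  have h2 : m + 3 - 1 = m + 2 := by lia
  rw [h1, h2]
  push_cast
  have hm : (0 : ℝ) ≤ m := Nat.cast_nonneg m
  nlinarith [pow_nonneg hm 3, pow_nonneg hm 2]

/-- If light cones have size at most `n ^ (1 / 4)` and gates are small compared to `n ^ (1 / 4)`,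
then few triples are not separated. The constant `432 = 24 * 18` comes from the factor `24` in the
bound `6 * n ^ 2 * (2 * x * ε * x) ^ 2 = 24 * ε ^ 2 * n ^ 3`, for `x = n ^ (1 / 4)` and
`ε = √(c / 432)`, and from the bound `2 / 9 * n ^ 3` on the number of triples. -/
theorem nonseparated_bound {n k M : ℕ} {c : ℝ} (hc : 0 < c) (hn : 3 ≤ n)
    (hk : (k : ℝ) ≤ √(c / 432) * (n : ℝ) ^ (1 / 4 : ℝ)) (hM : (M : ℝ) ≤ (n : ℝ) ^ (1 / 4 : ℝ)) :
    ((6 * (n * ((M + 1) * k) ^ 2 * n) : ℕ) : ℝ) ≤ c / 4 * Nat.card (Fin 3 ↪ Fin n) := by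
  have hn1 : (1 : ℝ) ≤ n := by exact_mod_cast (by lia : 1 ≤ n)
  set x : ℝ := (n : ℝ) ^ (1 / 4 : ℝ) with hx
  have hx1 : 1 ≤ x := Real.one_le_rpow hn1 (by norm_num)
  have hx4 : x ^ 4 = n := by
    rw [hx, ← Real.rpow_natCast, ← Real.rpow_mul (by positivity)]
    norm_num
  have h1 : ((M : ℝ) + 1) * k ≤ (2 * x) * (√(c / 432) * x) :=
    mul_le_mul (by linarith) hk (by positivity) (by positivity)
  have h2 : (((M : ℝ) + 1) * k) ^ 2 ≤ 4 * (c / 432) * n := by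
    calc (((M : ℝ) + 1) * k) ^ 2 ≤ ((2 * x) * (√(c / 432) * x)) ^ 2 :=
          pow_le_pow_left₀ (by positivity) h1 2
      _ = 4 * (√(c / 432)) ^ 2 * x ^ 4 := by ring
      _ = 4 * (c / 432) * n := by rw [Real.sq_sqrt (by positivity), hx4]
  have h3 := mul_le_mul_of_nonneg_left (natCast_card_triple n hn) (by positivity : 0 ≤ c / 4)
  have h4 := mul_le_mul_of_nonneg_left h2 (by positivity : (0 : ℝ) ≤ 6 * (n * n))
  push_cast
  calc 6 * ((n : ℝ) * (((M : ℝ) + 1) * k) ^ 2 * n) = 6 * (n * n) * (((M : ℝ) + 1) * k) ^ 2 := by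
        ring
    _ ≤ 6 * (n * n) * (4 * (c / 432) * n) := h4
    _ = c / 4 * (2 / 9 * (n : ℝ) ^ 3) := by ring
    _ ≤ _ := h3

/-- If a relation holds for a fraction `c` of the pairs, and at most a fraction `c / 4` of the
second components are bad, then for some good second component it holds for a fraction `c / 2` of
the first components. -/
theorem exists_good_of_card_pairs {α β : Type*} [Finite α] [Finite β] [Nonempty α] [Nonempty β]
    {P : α → β → Prop} {good : β → Prop} {c : ℝ} (hc : 0 < c)
    (hP : c * (Nat.card (α × β)) ≤ Nat.card {e : α × β // P e.1 e.2})
    (hgood : (Nat.card {b // ¬ good b} : ℝ) ≤ c / 4 * Nat.card β) :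
    ∃ b, good b ∧ c / 2 * Nat.card α ≤ Nat.card {a // P a b} := by
  classical
  have := Fintype.ofFinite α
  have := Fintype.ofFinite β
  by_contra! h
  have hα : (0 : ℝ) < Nat.card α := by exact_mod_cast Nat.card_pos
  have hβ : (0 : ℝ) < Nat.card β := by exact_mod_cast Nat.card_pos
  have hsum : (Nat.card {e : α × β // P e.1 e.2} : ℝ) = ∑ b, (Nat.card {a // P a b} : ℝ) := by
    have e : {e : α × β // P e.1 e.2} ≃ Σ b, {a // P a b} :=
      { toFun := fun e => ⟨e.1.2, e.1.1, e.2⟩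
        invFun := fun s => ⟨(s.2.1, s.1), s.2.2⟩
        left_inv := fun _ => rfl
        right_inv := fun _ => rfl }
    rw [Nat.card_congr e, Nat.card_sigma]
    push_cast
    rfl
  have hb (b : β) : (Nat.card {a // P a b} : ℝ) ≤
      c / 2 * Nat.card α + if ¬ good b then (Nat.card α : ℝ) else 0 := by
    by_cases hg : good b
    · simpa [hg] using (h b hg).le
    · have h1 : (Nat.card {a // P a b} : ℝ) ≤ Nat.card α := by
        exact_mod_cast Nat.card_le_card_of_injective _ Subtype.val_injective
      rw [if_pos hg]
      nlinarith [mul_pos hc hα]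
  have hbad : ∑ b, (if ¬ good b then (Nat.card α : ℝ) else 0) =
      Nat.card {b // ¬ good b} * Nat.card α := by
    rw [← Finset.sum_filter, Finset.sum_const, nsmul_eq_mul,
      Nat.card_eq_fintype_card (α := {b // ¬ good b}),
      Fintype.card_subtype]
  have htot : c * (Nat.card α * Nat.card β) ≤
      Nat.card β * (c / 2 * Nat.card α) + c / 4 * Nat.card β * Nat.card α := by
    calc c * (Nat.card α * Nat.card β) ≤ ∑ b, (Nat.card {a // P a b} : ℝ) := by
          rw [← hsum, ← Nat.cast_mul, ← Nat.card_prod]; exact hP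
      _ ≤ ∑ b, (c / 2 * Nat.card α + if ¬ good b then (Nat.card α : ℝ) else 0) :=
          Finset.sum_le_sum fun b _ => hb b
      _ = Nat.card β * (c / 2 * Nat.card α) + Nat.card {b // ¬ good b} * Nat.card α := by
          rw [Finset.sum_add_distrib, hbad, Finset.sum_const, nsmul_eq_mul, Finset.card_univ,
            Nat.card_eq_fintype_card (α := β)]
      _ ≤ _ := by gcongr
  nlinarith [mul_pos (mul_pos hc hα) hβ]

theorem natCast_pow_le_rpow_of_lt {n K D : ℕ} (hn : 1 ≤ n) (hK : 2 ≤ K)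
    (hD : (D : ℝ) < 1 / 4 * (Real.log n / Real.log K)) :
    ((K ^ D : ℕ) : ℝ) ≤ (n : ℝ) ^ (1 / 4 : ℝ) := by
  have hn0 : (0 : ℝ) < n := by exact_mod_cast hn
  have hK1 : (1 : ℝ) < K := by exact_mod_cast hK
  have hlog : 0 < Real.log K := Real.log_pos hK1
  rw [← mul_div_assoc, lt_div_iff₀ hlog] at hD
  rw [Nat.cast_pow, ← Real.log_le_log_iff (by positivity) (by positivity), Real.log_pow,
    Real.log_rpow hn0]
  exact hD.le

theorem theorem3 (k d : ℕ → ℕ)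
    (hk : (fun n : ℕ => (k n : ℝ)) =o[atTop] (fun n : ℕ => (n : ℝ) ^ (1 / 4 : ℝ)))
    (A : CircuitArchitecture k d) (hA : LongRangeTripartiteMIE A) :
    ∃ α : ℝ, 0 < α ∧ ∃ n₀ : ℕ, 0 < n₀ ∧
      ∀ n : A.Γ, max n₀ ((10 * d n) ^ 4) ≤ (n : ℕ) →
        ∀ F : ProbClassicalCircuit (A.template n), ∀ K D : ℕ, 2 ≤ K →
          (∀ g, F.circuit.fanIn g ≤ K) → F.circuit.depth ≤ D →
          F.expectedError < α →
            (D : ℝ) ≥ 1 / 4 * (Real.log (n : ℕ) / Real.log K) := by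
  classical
  obtain ⟨c, hc, hMIE⟩ := hA
  have hN : (0 : ℝ) < Nat.card (Fin 3 → CliffordGate Unit) := by
    have : Nonempty (CliffordGate Unit) := ⟨Quotient.mk _ ⟨1, IsClifford.one⟩⟩
    exact_mod_cast Nat.card_pos
  have hε : 0 < √(c / 432) := Real.sqrt_pos.2 (by positivity)
  obtain ⟨n₁, hn₁⟩ := eventually_atTop.1 (hk.def hε)
  -- a triple has MIE in a fraction `c / 2` of the circuits, and the algorithm fails for a fraction
  -- of these that is at least the inverse of the number of rotations
  refine ⟨c / 2 / Nat.card (Fin 3 → CliffordGate Unit), by positivity, max 3 n₁, by positivity,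
    fun n hn F K D hK hf hD herr => ?_⟩
  have hn3 : 3 ≤ (n : ℕ) := (le_max_left _ _).trans ((le_max_left _ _).trans hn)
  have hkn : (k n : ℝ) ≤ √(c / 432) * ((n : ℕ) : ℝ) ^ (1 / 4 : ℝ) := by
    have h := hn₁ n ((le_max_right _ _).trans ((le_max_left _ _).trans hn))
    rwa [Real.norm_of_nonneg (by positivity), Real.norm_of_nonneg (by positivity)] at h
  by_contra! hlt
  have hM := natCast_pow_le_rpow_of_lt (by lia) hK hlt
  choose L hL hLF using F.exists_output_support (by lia) hf hD
  have hne : Nonempty (A.template n).Gates := ⟨fun w => Quotient.mk _ ⟨1, IsClifford.one⟩⟩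
  have hne' : Nonempty (Fin 3 ↪ Fin n) := ⟨Fin.castLEEmb hn3⟩
  have hpairs : (0 : ℝ) < Nat.card ((A.template n).Gates × (Fin 3 ↪ Fin n)) := by
    exact_mod_cast Nat.card_pos
  obtain ⟨t, ht, hcard⟩ := exists_good_of_card_pairs
    (P := fun (U : (A.template n).Gates) t => HasGHZTypeMIE (outputState (A.template n) U) t)
    (good := IsSeparated (A.template n) L) hc ((le_div_iff₀ hpairs).1 (hMIE n hn3)) (by
      refine le_trans ?_ (nonseparated_bound hc hn3 hkn hM)
      rw [Nat.card_eq_fintype_card, Fintype.card_subtype]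
      exact_mod_cast card_not_isSeparated_le (A.template n) (A.isLocal n) hL)
  refine absurd (F.le_expectedError fun r => ?_) (not_le.2 herr)
  have h := card_hasGHZTypeMIE_le (A.template n) ht (G := fun U => F.output U r)
    fun v U U' hUU => hLF v U U' r hUU
  rw [div_mul_eq_mul_div, div_le_iff₀ hN, mul_comm (Nat.cast _ : ℝ) (Nat.card (Fin 3 → _) : ℝ)]
  exact hcard.trans (by exact_mod_cast h)
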